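/- All graphs are finite, simple and undirected. A graph $H$ is a minor of a graph $G$ if there is a map $\phi$ from $V(H)$ to subsets of $V(G)$ such that the sets $\phi(v)$ are pairwise disjoint, each $G[\phi(v)]$ is connected (in particular $\phi(v)\neq\emptyset$), and for every edge $uv$ of $H$ there is an edge of $G$ between $\phi(u)$ and $\phi(v)$. Consider the following parameterized problem. An instance is a triple $(G,X,t)$ consisting of a graph $G$, a vertex cover $X$ of $G$ and an integer $t\ge 1$; the parameter is $|X|$; the question is whether $G$ contains the complete graph $K_t$ as a minor. Instances are encoded as strings over a fixed finite alphabet (adjacency matrix of $G$, characteristic vector of $X$, $t$ in binary). Theorem. This problem admits a polynomial kernel with $O(|X|^4)$ vertices. That is, there are a polynomial-time algorithm, a computable function $f:\mathbb N\to\mathbb N$ that is bounded by a polynomial, and a function $g:\mathbb N\to\mathbb N$ with $g(k)=O(k^4)$ as $k\to\infty$, such that the algorithm transforms every instance $(G,X,t)$ into an instance $(G',X',t')$ of the same problem for which 1. $G'$ contains $K_{t'}$ as a minor if and only if $G$ contains $K_t$ as a minor; 2. the encoding length of $(G',X',t')$ and the parameter $|X'|$ are both at most $f(|X|)$; 3.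 $|V(G')|\le g(|X|)$. -/

import Mathlib

/-- A *minor model* of `H` in `G`: pairwise disjoint branch sets `φ w ⊆ V(G)`, each inducing a
connected (in particular nonempty) subgraph of `G`, such that for every edge `uv` of `H` there is
an edge of `G` between `φ u` and `φ v`. -/
structure IsMinorModel {V W : Type*} (H : SimpleGraph W) (G : SimpleGraph V) (φ : W → Set V) :
    Prop where
  disjoint : ∀ u v, u ≠ v → Disjoint (φ u) (φ v)
  connected : ∀ v, (G.induce (φ v)).Connected
  adj : ∀ u v, H.Adj u v → ∃ x ∈ φ u, ∃ y ∈ φ v, G.Adj x y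

/-- `H` is a minor of `G` if `G` has a minor model of `H`. -/
def IsMinorOf {V W : Type*} (H : SimpleGraph W) (G : SimpleGraph V) : Prop :=
  ∃ φ : W → Set V, IsMinorModel H G φ

/-- A parameterized problem, given by its instances, the strings over the alphabet `Γ` that
represent them, the parameter of an instance, and the set of yes-instances. -/
structure ParameterizedProblem (Γ : Type) where
  Instance : Type
  encode : Instance → List Γ
  encode_injective : Function.Injective encode
  param : Instance → ℕ
  IsYes : Instance → Prop

/-- `K` is a kernelization algorithm of size `f` for `Q`: it is computed by a (multi-stack) Turing
machine in a number of steps polynomial in the length of the encoded input, it maps every instance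
to an equivalent one, `f` is a computable function, and both the encoding length and the parameter
of the output are at most `f` of the parameter of the input. -/
structure IsKernelization {Γ : Type} (Q : ParameterizedProblem Γ) (K : Q.Instance → Q.Instance)
    (f : ℕ → ℕ) : Prop where
  polyTime : Nonempty (Turing.TM2ComputableInPolyTime Q.encode Q.encode K)
  equivalent : ∀ I, Q.IsYes (K I) ↔ Q.IsYes I
  computable_size : Computable f
  length_le : ∀ I, (Q.encode (K I)).length ≤ f (Q.param I)
  param_le : ∀ I, Q.param (K I) ≤ f (Q.param I)

/-- A graph `G` on the vertices `0, …, n - 1`, a vertex cover `X` of `G`, and an integer `t ≥ 1`. -/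
@[ext]
structure CliqueMinorInstance where
  n : ℕ
  G : SimpleGraph (Fin n)
  X : Finset (Fin n)
  isVertexCover : G.IsVertexCover (X : Set (Fin n))
  t : ℕ
  one_le_t : 1 ≤ t

namespace CliqueMinorInstance

open Computability

open scoped Classical in
/-- The part of the encoding that belongs to vertex `i`: one bit that tells whether `i ∈ X`, then
row `i` of the adjacency matrix, then a comma. -/
noncomputable def encodeRow (I : CliqueMinorInstance) (i : Fin I.n) : List Γ' :=
  Γ'.bit (decide (i ∈ I.X)) ::
    ((List.finRange I.n).map (fun j => Γ'.bit (decide (I.G.Adj i j))) ++ [Γ'.comma])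

/-- The string that represents an instance: `t` in binary, a comma, and the rows of the
vertices `0, …, n - 1`. -/
noncomputable def encode (I : CliqueMinorInstance) : List Γ' :=
  (encodeNat I.t).map Γ'.bit ++ Γ'.comma :: (List.finRange I.n).flatMap I.encodeRow

theorem encode_injective : Function.Injective encode := by
  classical
  have split : ∀ (a b : List Bool) (u v : List Γ'),
      a.map Γ'.bit ++ Γ'.comma :: u = b.map Γ'.bit ++ Γ'.comma :: v → a = b ∧ u = v := by
    intro a
    induction a with
    | nil => intro b u v h; cases b <;> simp_all
    | cons x a ih =>
      intro b u v h
      cases b with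
      | nil => simp at h
      | cons y b =>
        simp only [List.map_cons, List.cons_append, List.cons.injEq, Γ'.bit.injEq] at h
        obtain ⟨h1, h2⟩ := ih b u v h.2
        exact ⟨by rw [h.1, h1], h2⟩
  have rows : ∀ {α : Type} (l : List α) (f g : α → List Γ'),
      (∀ i, (f i).length = (g i).length) → l.flatMap f = l.flatMap g → ∀ i ∈ l, f i = g i := by
    intro α l f g hl
    induction l with
    | nil => simp
    | cons x l ih =>
      intro h
      simp only [List.flatMap_cons] at h
      obtain ⟨h1, h2⟩ := List.append_inj h (hl x)
      simpa [h1] using ih h2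
  have len : ∀ I : CliqueMinorInstance,
      ((List.finRange I.n).flatMap I.encodeRow).length = I.n * (I.n + 2) := by
    intro I
    simp [List.length_flatMap, encodeRow]
  rintro ⟨n, G, X, hX, t, ht⟩ ⟨n', G', X', hX', t', ht'⟩ h
  obtain ⟨h1, h2⟩ := split _ _ _ _ h
  have e1 : t = t' := by
    have := congrArg decodeNat h1
    simpa using this
  have e2 : n = n' := by
    have := congrArg List.length h2
    rw [len, len] at this
    simp only at this
    rcases lt_trichotomy n n' with h | h | h
    · nlinarith
    · exact h
    · nlinarith
  subst e1 e2
  have h3 := rows _ _ _ (fun i => by simp [encodeRow]) h2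
  have e3 : X = X' := by
    ext i
    have := h3 i (List.mem_finRange i)
    simp only [encodeRow, List.cons.injEq, Γ'.bit.injEq, decide_eq_decide] at this
    exact this.1
  have e4 : G = G' := by
    ext i j
    have := h3 i (List.mem_finRange i)
    simp only [encodeRow, List.cons.injEq, List.append_cancel_right_eq] at this
    have := List.map_inj_left.1 this.2 j (List.mem_finRange j)
    simpa using this
  subst e3 e4
  rfl

end CliqueMinorInstance

/-- Given a graph `G` with a vertex cover `X` and an integer `t ≥ 1`, does `G` contain the complete
graph `K_t` as a minor? The parameter is `|X|`. -/
noncomputable def cliqueMinorTestVC : ParameterizedProblem Computability.Γ' where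
  Instance := CliqueMinorInstance
  encode := CliqueMinorInstance.encode
  encode_injective := CliqueMinorInstance.encode_injective
  param I := I.X.card
  IsYes I := IsMinorOf (SimpleGraph.completeGraph (Fin I.t)) I.G

/-! Write `k = |X|`. A model of a complete graph can be thinned until it uses at most `k² + 1`
vertices outside `X` (`IsMinorModel.exists_sparse`). For each ordered pair `(p, q)` in `X`, a single
vertex of the branch set of `p` adjacent to both `p` and `q` is enough. At most one branch set
avoids `X`, and it is a single vertex because the vertices outside `X` are independent. So if two
vertices of `X` have `k² + 2` common neighbors outside `X`, one of these is free and can stand in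
for an edge between the two. Joining all such pairs (`saturation`) therefore does not change the
answer.

Now let `v` be a vertex outside `X` whose neighbors form a clique after saturation. If its degree is
at least `t - 1`, then `v` and its neighbors contain `K_t`. Otherwise `v` cannot be a branch set on
its own, since `t - 1` other branch sets would need distinct neighbors of `v`. Inside a larger
branch set it can be bypassed (`IsMinorModel.diff_simplicial`). Hence these vertices either settle
the instance or can all be deleted. Each remaining vertex outside `X` is a common neighbor of two
vertices of `X` that are still nonadjacent. There are at most `k²` such ordered pairs, each with at
most `k² + 1` common neighbors outside `X`, which leaves at most `k + k² (k² + 1)` vertices. If `t >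
k + 1`, the answer is no (`IsMinorModel.card_le`), so `t` may be taken to be small as well.

For the running time, a small imperative language on stacks is translated into Turing machines step
by step (`Runs.iterate_step`). The classes `PolyFun`, `PolyPred` and `PolyOut` of numerical
functions, predicates and written strings are closed under enough arithmetic, counting, bounded
quantification and looping to describe the kernel. Numbers are held in unary. Only `t`, given in
binary, could be too large for this: it is capped at `n + 2` for comparisons, and its digits are
copied to the output. -/

/-! ### Stack programs and their translation into Turing machines. -/

/-- Programs that act on stacks indexed by `K` with symbols in `Γ`. The tests of `ite` and `loop`
look at the top of a stack without removing it. -/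
inductive StackProg (K Γ : Type) : Type
  | push (k : K) (a : Γ)
  | pop (k : K)
  | mv (k k' : K)
  | seq (c d : StackProg K Γ)
  | ite (k : K) (p : Option Γ → Bool) (c d : StackProg K Γ)
  | loop (k : K) (p : Option Γ → Bool) (c : StackProg K Γ)

namespace StackProg

open Function Turing

variable {K Γ : Type}

/-- The labels of the machine that executes a program. -/
def Label : StackProg K Γ → Type
  | push _ _ => Unit
  | pop _ => Unit
  | mv _ _ => Unit
  | seq c d => Label c ⊕ Label d
  | ite _ _ c d => Option (Label c ⊕ Label d)
  | loop _ _ c => Option (Label c)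

/-- The label at which the execution of a program starts. -/
def entry : (c : StackProg K Γ) → c.Label
  | push _ _ => ()
  | pop _ => ()
  | mv _ _ => ()
  | seq c _ => Sum.inl (entry c)
  | ite _ _ _ _ => none
  | loop _ _ _ => none

instance fintypeLabel : (c : StackProg K Γ) → Fintype c.Label
  | push _ _ => inferInstanceAs (Fintype Unit)
  | pop _ => inferInstanceAs (Fintype Unit)
  | mv _ _ => inferInstanceAs (Fintype Unit)
  | seq c d =>
    letI := fintypeLabel c
    letI := fintypeLabel d
    inferInstanceAs (Fintype (Label c ⊕ Label d))
  | ite _ _ c d =>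
    letI := fintypeLabel c
    letI := fintypeLabel d
    inferInstanceAs (Fintype (Option (Label c ⊕ Label d)))
  | loop _ _ c =>
    letI := fintypeLabel c
    inferInstanceAs (Fintype (Option (Label c)))

/-- The statements of the machine that executes a program, when its labels are embedded into the
labels of a larger machine by `emb` and the execution continues at `exit`. -/
def code [Inhabited Γ] {Λ : Type} : (c : StackProg K Γ) → (emb : c.Label → Λ) → (exit : Λ) →
    c.Label → TM2.Stmt (fun _ : K => Γ) Λ (Option Γ)
  | push k a, _, exit, _ => .push k (fun _ => a) (.goto fun _ => exit)
  | pop k, _, exit, _ => .pop k (fun v _ => v) (.goto fun _ => exit)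
  | mv k k', _, exit, _ =>
    .pop k (fun _ o => o)
      (.branch Option.isSome (.push k' (fun v => v.getD default) (.goto fun _ => exit))
        (.goto fun _ => exit))
  | seq c d, emb, exit, l =>
    match l with
    | Sum.inl l => code c (fun l => emb (Sum.inl l)) (emb (Sum.inr (entry d))) l
    | Sum.inr l => code d (fun l => emb (Sum.inr l)) exit l
  | ite k p c d, emb, exit, l =>
    match l with
    | none => .peek k (fun _ o => o)
        (.branch p (.goto fun _ => emb (some (Sum.inl (entry c))))
          (.goto fun _ => emb (some (Sum.inr (entry d)))))
    | some (Sum.inl l) => code c (fun l => emb (some (Sum.inl l))) exit l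
    | some (Sum.inr l) => code d (fun l => emb (some (Sum.inr l))) exit l
  | loop k p c, emb, exit, l =>
    match l with
    | none => .peek k (fun _ o => o)
        (.branch p (.goto fun _ => emb (some (entry c))) (.goto fun _ => exit))
    | some l => code c (fun l => emb (some l)) (emb none) l

variable [DecidableEq K]

/-- `Runs c s s' n`: started on the stacks `s`, the program `c` ends on the stacks `s'` after `n`
steps. -/
inductive Runs : StackProg K Γ → (K → List Γ) → (K → List Γ) → ℕ → Prop
  | push (k a s) : Runs (push k a) s (update s k (a :: s k)) 1
  | pop (k s) : Runs (pop k) s (update s k (s k).tail) 1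
  | mv_cons {k k' s a l} (h : s k = a :: l) :
      Runs (mv k k') s (update (update s k l) k' (a :: update s k l k')) 1
  | mv_nil {k k' s} (h : s k = []) : Runs (mv k k') s s 1
  | seq {c d s s' s'' m n} (hc : Runs c s s' m) (hd : Runs d s' s'' n) :
      Runs (seq c d) s s'' (m + n)
  | ite_true {k p c d s s' n} (hp : p (s k).head? = true) (hc : Runs c s s' n) :
      Runs (ite k p c d) s s' (n + 1)
  | ite_false {k p c d s s' n} (hp : p (s k).head? = false) (hd : Runs d s s' n) :
      Runs (ite k p c d) s s' (n + 1)
  | loop_true {k p c s s' s'' m n} (hp : p (s k).head? = true) (hc : Runs c s s' m)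
      (hl : Runs (loop k p c) s' s'' n) : Runs (loop k p c) s s'' (n + m + 1)
  | loop_false {k p c s} (hp : p (s k).head? = false) : Runs (loop k p c) s s 1

/-- Every primitive instruction and every test is one statement of the machine, so the step counts
agree exactly. The internal state at the start is arbitrary because each test loads it afresh before
branching. The general embedding `emb` and the exit label are what let the induction pass to
subprograms. -/
theorem Runs.iterate_step [Inhabited Γ] {Λ : Type} {M : Λ → TM2.Stmt (fun _ : K => Γ) Λ (Option Γ)}
    {c : StackProg K Γ} {s s' : K → List Γ} {n : ℕ} (h : Runs c s s' n) :
    ∀ (emb : c.Label → Λ) (exit : Λ), (∀ l, M (emb l) = code c emb exit l) → ∀ v : Option Γ,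
      ∃ v' : Option Γ, (flip bind (TM2.step M))^[n] (some ⟨some (emb (entry c)), v, s⟩) =
        some ⟨some exit, v', s'⟩ := by
  induction h with
  | push k a s =>
    intro emb exit hM v
    exact ⟨v, by simp [flip, TM2.step, hM, code]⟩
  | pop k s =>
    intro emb exit hM v
    exact ⟨v, by simp [flip, TM2.step, hM, code]⟩
  | @mv_cons k k' s a l h =>
    intro emb exit hM v
    exact ⟨some a, by simp [flip, TM2.step, hM, code, h]⟩
  | @mv_nil k k' s h =>
    intro emb exit hM v
    refine ⟨none, ?_⟩
    have : update s k [] = s := by rw [← h, update_eq_self]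
    simp [flip, TM2.step, hM, code, h, this]
  | seq hc hd ihc ihd =>
    intro emb exit hM v
    obtain ⟨v₁, h₁⟩ := ihc (fun l => emb (Sum.inl l)) (emb (Sum.inr (entry _)))
      (fun l => hM (Sum.inl l)) v
    obtain ⟨v₂, h₂⟩ := ihd (fun l => emb (Sum.inr l)) exit (fun l => hM (Sum.inr l)) v₁
    refine ⟨v₂, ?_⟩
    rw [Nat.add_comm, iterate_add_apply]
    exact (congrArg _ h₁).trans h₂
  | @ite_true k p c d s s' n hp hc ih =>
    intro emb exit hM v
    obtain ⟨v₁, h₁⟩ := ih (fun l => emb (some (Sum.inl l))) exit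
      (fun l => hM (some (Sum.inl l))) (s k).head?
    refine ⟨v₁, ?_⟩
    rw [iterate_succ_apply, ← h₁]
    congr 1
    have := hM none
    simp [flip, TM2.step, entry, this, code, hp]
  | @ite_false k p c d s s' n hp hc ih =>
    intro emb exit hM v
    obtain ⟨v₁, h₁⟩ := ih (fun l => emb (some (Sum.inr l))) exit
      (fun l => hM (some (Sum.inr l))) (s k).head?
    refine ⟨v₁, ?_⟩
    rw [iterate_succ_apply, ← h₁]
    congr 1
    have := hM none
    simp [flip, TM2.step, entry, this, code, hp]
  | @loop_true k p c s s' s'' m n hp hc hl ihc ihl =>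
    intro emb exit hM v
    obtain ⟨v₁, h₁⟩ := ihc (fun l => emb (some l)) (emb none)
      (fun l => hM (some l)) (s k).head?
    obtain ⟨v₂, h₂⟩ := ihl emb exit hM v₁
    refine ⟨v₂, ?_⟩
    rw [iterate_succ_apply, iterate_add_apply]
    refine Eq.trans ?_ ((congrArg _ h₁).trans h₂)
    congr 2
    have := hM none
    simp [flip, TM2.step, entry, this, code, hp]
  | @loop_false k p c s hp =>
    intro emb exit hM v
    have := hM none
    exact ⟨(s k).head?, by simp [flip, TM2.step, entry, this, code, hp]⟩

/-- `RunsIn c s s' T`: started on the stacks `s`, the program `c` ends on the stacks `s'` after at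
most `T` steps. -/
def RunsIn (c : StackProg K Γ) (s s' : K → List Γ) (T : ℕ) : Prop :=
  ∃ n ≤ T, Runs c s s' n

/-- The machine that executes the program `c` with input stack `k₀` and output stack `k₁`. -/
def machine [Inhabited Γ] [Fintype Γ] [Fintype K] (c : StackProg K Γ) (k₀ k₁ : K) : FinTM2 where
  K := K
  k₀ := k₀
  k₁ := k₁
  Γ := fun _ => Γ
  Λ := Option c.Label
  main := some c.entry
  σ := Option Γ
  initialState := none
  m := fun l => match l with
    | some l => code c some none l
    -- A halting configuration must be in the initial internal state, so one extra step resets it;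
    -- this is the `+ 1` in the time bound.
    | none => .load (fun _ => none) .halt

/-- `initList` and `haltList` describe their stacks by such a cast, which is harmless because all
stacks share one alphabet. -/
theorem dite_mpr_eq_update (k k₀ : K) (l : List Γ) (h : k = k₀ → List Γ = List Γ) :
    (if h' : k = k₀ then (h h').mpr l else []) = update (fun _ => []) k₀ l k := by
  by_cases hk : k = k₀
  · simp [hk]
  · simp [hk]

/-- A function that a program computes in polynomially many steps is computed by a Turing machine
in polynomial time. -/
theorem nonempty_computableInPolyTime [Inhabited Γ] [Fintype Γ] [Fintype K] {α β : Type}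
    (ea : α → List Γ) (eb : β → List Γ) (f : α → β) (c : StackProg K Γ) (k₀ k₁ : K)
    (T : Polynomial ℕ)
    (h : ∀ a, RunsIn c (update (fun _ => []) k₀ (ea a)) (update (fun _ => []) k₁ (eb (f a)))
      (T.eval (ea a).length)) :
    Nonempty (TM2ComputableInPolyTime ea eb f) := by
  refine ⟨{ tm := machine c k₀ k₁, inputAlphabet := Equiv.refl _, outputAlphabet := Equiv.refl _,
            time := T + 1, outputsFun := fun a => ?_ }⟩
  choose n hn hr using h
  refine ⟨⟨n a + 1, ?_⟩, by simpa using hn a⟩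
  obtain ⟨v', hv⟩ := (hr a).iterate_step (M := (machine c k₀ k₁).m) some none (fun l => rfl) none
  have e1 : initList (machine c k₀ k₁) (List.map (Equiv.refl Γ).invFun (ea a)) =
      (⟨some (some c.entry), none, update (fun _ => []) k₀ (ea a)⟩ :
        TM2.Cfg (fun _ : K => Γ) (Option c.Label) (Option Γ)) := by
    unfold initList
    congr 1
    funext (k : K)
    refine (dite_mpr_eq_update k k₀ _ fun _ => rfl).trans ?_
    exact congrArg (fun l => update _ _ l k) (List.map_id (ea a))
  have e2 : haltList (machine c k₀ k₁) (List.map (Equiv.refl Γ).invFun (eb (f a))) =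
      (⟨none, none, update (fun _ => []) k₁ (eb (f a))⟩ :
        TM2.Cfg (fun _ : K => Γ) (Option c.Label) (Option Γ)) := by
    unfold haltList
    congr 1
    funext (k : K)
    refine (dite_mpr_eq_update k k₁ _ fun _ => rfl).trans ?_
    exact congrArg (fun l => update _ _ l k) (List.map_id (eb (f a)))
  change (flip bind (TM2.step (machine c k₀ k₁).m))^[n a + 1]
    (some (initList (machine c k₀ k₁) (List.map (Equiv.refl Γ).invFun (ea a)))) =
    some (haltList (machine c k₀ k₁) (List.map (Equiv.refl Γ).invFun (eb (f a))))
  rw [e1, e2, iterate_succ_apply']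
  refine (congrArg _ hv).trans ?_
  rfl

end StackProg

/-! ### Running times of stack programs. -/

section

namespace StackProg

open Function

variable {K Γ : Type} [DecidableEq K]

theorem RunsIn.mono {c : StackProg K Γ} {s s' : K → List Γ} {T T' : ℕ} (h : RunsIn c s s' T)
    (hT : T ≤ T') : RunsIn c s s' T' :=
  let ⟨n, hn, hr⟩ := h
  ⟨n, hn.trans hT, hr⟩

theorem RunsIn.seq {c d : StackProg K Γ} {s s' s'' : K → List Γ} {T T' : ℕ}
    (hc : RunsIn c s s' T) (hd : RunsIn d s' s'' T') : RunsIn (seq c d) s s'' (T + T') :=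
  let ⟨_, hm, hc⟩ := hc
  let ⟨_, hn, hd⟩ := hd
  ⟨_, add_le_add hm hn, hc.seq hd⟩

theorem runsIn_push (k : K) (a : Γ) (s : K → List Γ) :
    RunsIn (push k a) s (update s k (a :: s k)) 1 :=
  ⟨1, le_rfl, .push k a s⟩

theorem runsIn_pop (k : K) (s : K → List Γ) : RunsIn (pop k) s (update s k (s k).tail) 1 :=
  ⟨1, le_rfl, .pop k s⟩

theorem runsIn_mv {k k' : K} {s : K → List Γ} {a : Γ} {l : List Γ} (h : s k = a :: l) :
    RunsIn (mv k k') s (update (update s k l) k' (a :: update s k l k')) 1 :=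
  ⟨1, le_rfl, .mv_cons h⟩

theorem RunsIn.ite {c d : StackProg K Γ} {s s' : K → List Γ} {T : ℕ} {k : K} {p : Option Γ → Bool}
    (hc : p (s k).head? = true → RunsIn c s s' T) (hd : p (s k).head? = false → RunsIn d s s' T) :
    RunsIn (ite k p c d) s s' (T + 1) := by
  rcases hp : p (s k).head? with _ | _
  · obtain ⟨n, hn, hr⟩ := hd hp
    exact ⟨n + 1, by omega, .ite_false hp hr⟩
  · obtain ⟨n, hn, hr⟩ := hc hp
    exact ⟨n + 1, by omega, .ite_true hp hr⟩

/-- The states `S j` are indexed by the number `j` of iterations still to come, which suits loops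
driven by a unary counter. Each iteration costs one test besides its body, and one last test fails.
-/
theorem runsIn_loop {c : StackProg K Γ} {k : K} {p : Option Γ → Bool} {T : ℕ}
    (S : ℕ → K → List Γ) (m : ℕ) (h0 : p (S 0 k).head? = false)
    (hp : ∀ j < m, p (S (j + 1) k).head? = true)
    (hc : ∀ j < m, RunsIn c (S (j + 1)) (S j) T) :
    RunsIn (loop k p c) (S m) (S 0) (m * (T + 1) + 1) := by
  induction m with
  | zero => exact ⟨1, by omega, .loop_false h0⟩
  | succ m ih =>
    obtain ⟨n, hn, hr⟩ := ih (fun j hj => hp j (by omega)) (fun j hj => hc j (by omega))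
    obtain ⟨n', hn', hr'⟩ := hc m (by omega)
    exact ⟨n + n' + 1, by rw [Nat.succ_mul]; omega, .loop_true (hp m (by omega)) hr' hr⟩

/-- Moving all symbols of a stack to another one. -/
theorem runsIn_moveAll {k k' : K} (hk : k ≠ k') (s : K → List Γ) :
    RunsIn (loop k Option.isSome (mv k k')) s
      (update (update s k []) k' ((s k).reverse ++ s k')) (2 * (s k).length + 1) := by
  generalize hl : s k = l
  induction l generalizing s with
  | nil =>
    refine ⟨1, by simp, ?_⟩
    have : update (update s k []) k' (([] : List Γ).reverse ++ s k') = s := by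
      rw [← hl, update_eq_self]; simp [hl]
    rw [this]
    exact .loop_false (by simp [hl])
  | cons a l ih =>
    obtain ⟨n, hn, hr⟩ := ih (update (update s k l) k' (a :: s k')) (by simp [hk])
    refine ⟨n + 1 + 1, by simp only [List.length_cons]; omega, ?_⟩
    have h1 := Runs.mv_cons (k' := k') hl
    rw [update_of_ne hk.symm] at h1
    refine .loop_true (by simp [hl]) h1 ?_
    convert hr using 1
    funext j
    by_cases h1 : j = k'
    · subst h1; simp
    · by_cases h2 : j = k
      · subst h2; simp [hk]
      · simp [h1, h2]

/-- Moving the first symbols of a stack to another one, as long as they equal `a`. -/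
theorem runsIn_moveWhile [DecidableEq Γ] {k k' : K} (hk : k ≠ k') (a : Γ) (s : K → List Γ) (n : ℕ)
    (l : List Γ) (hs : s k = List.replicate n a ++ l) (hl : l.head? ≠ some a) :
    RunsIn (loop k (fun o => decide (o = some a)) (mv k k')) s
      (update (update s k l) k' (List.replicate n a ++ s k')) (2 * n + 1) := by
  have h := runsIn_loop (c := mv k k') (k := k) (p := fun o => decide (o = some a)) (T := 1)
    (fun j => update (update s k (List.replicate j a ++ l)) k'
      (List.replicate (n - j) a ++ s k')) n (by simp [hk, hl])
    (by intro j hj; simp [hk, List.replicate_succ]) (by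
      intro j hj
      have h1 := runsIn_mv (k := k) (k' := k') (a := a) (l := List.replicate j a ++ l)
        (s := update (update s k (List.replicate (j + 1) a ++ l)) k'
          (List.replicate (n - (j + 1)) a ++ s k')) (by simp [hk, List.replicate_succ])
      convert h1 using 1
      have e : n - j = n - (j + 1) + 1 := by omega
      rw [e, List.replicate_succ (n := n - (j + 1))]
      funext i
      by_cases h1 : i = k'
      · subst h1; simp [hk.symm]
      · by_cases h2 : i = k
        · subst h2; simp [update_apply, hk]
        · simp [h1, h2])
  have e0 : update (update s k (List.replicate n a ++ l)) k'
      (List.replicate (n - n) a ++ s k') = s := by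
    rw [← hs]; simp
  simp only [e0] at h
  simpa [mul_comm] using h

/-- Emptying a stack. -/
theorem runsIn_clear (k : K) (s : K → List Γ) :
    RunsIn (loop k Option.isSome (pop k)) s (update s k []) (2 * (s k).length + 1) := by
  generalize hl : s k = l
  induction l generalizing s with
  | nil =>
    refine ⟨1, by simp, ?_⟩
    rw [← hl, update_eq_self]
    exact .loop_false (by simp [hl])
  | cons a l ih =>
    obtain ⟨n, hn, hr⟩ := ih (update s k l) (by simp)
    refine ⟨n + 1 + 1, by simp only [List.length_cons]; omega, ?_⟩
    have h1 := Runs.pop k s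
    rw [hl, List.tail_cons] at h1
    refine .loop_true (by simp [hl]) h1 ?_
    simpa using hr

end StackProg

/-! ### The stacks used for evaluating expressions. -/

open Computability

/-- The stacks that are used for the evaluation of expressions: the input with an auxiliary stack to
read it, two stacks for intermediate results, the stack of values, the output, and one stack for each
variable. -/
inductive Reg
  | inp | aux | tmp | cnt | val | out
  | var (i : Fin 6)
  deriving DecidableEq, Fintype

namespace Reg

open Function StackProg

/-- The symbol for unary numbers. -/
abbrev tick : Γ' := Γ'.bit true

/-- Is the top symbol of a stack a tick? -/
abbrev isTick (o : Option Γ') : Bool := decide (o = some tick)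

/-- The stacks with the given contents, where variables hold unary numbers. -/
def conf (inp aux tmp cnt val out : List Γ') (e : Fin 6 → ℕ) : Reg → List Γ'
  | .inp => inp
  | .aux => aux
  | .tmp => tmp
  | .cnt => cnt
  | .val => val
  | .out => out
  | .var i => List.replicate (e i) tick

/-- A unary number on the stack of values. -/
def block (n : ℕ) : List Γ' := List.replicate n tick ++ [Γ'.comma]

section

variable (inp aux tmp cnt val out l : List Γ') (e : Fin 6 → ℕ) (i : Fin 6) (n : ℕ)

@[simp] theorem conf_inp : conf inp aux tmp cnt val out e .inp = inp := rfl
@[simp] theorem conf_aux : conf inp aux tmp cnt val out e .aux = aux := rfl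
@[simp] theorem conf_tmp : conf inp aux tmp cnt val out e .tmp = tmp := rfl
@[simp] theorem conf_cnt : conf inp aux tmp cnt val out e .cnt = cnt := rfl
@[simp] theorem conf_val : conf inp aux tmp cnt val out e .val = val := rfl
@[simp] theorem conf_out : conf inp aux tmp cnt val out e .out = out := rfl
@[simp] theorem conf_var :
    conf inp aux tmp cnt val out e (.var i) = List.replicate (e i) tick := rfl

@[simp] theorem update_inp : update (conf inp aux tmp cnt val out e) .inp l =
    conf l aux tmp cnt val out e := by
  funext k; cases k <;> simp

@[simp] theorem update_aux : update (conf inp aux tmp cnt val out e) .aux l =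
    conf inp l tmp cnt val out e := by
  funext k; cases k <;> simp

@[simp] theorem update_tmp : update (conf inp aux tmp cnt val out e) .tmp l =
    conf inp aux l cnt val out e := by
  funext k; cases k <;> simp

@[simp] theorem update_cnt : update (conf inp aux tmp cnt val out e) .cnt l =
    conf inp aux tmp l val out e := by
  funext k; cases k <;> simp

@[simp] theorem update_val : update (conf inp aux tmp cnt val out e) .val l =
    conf inp aux tmp cnt l out e := by
  funext k; cases k <;> simp

@[simp] theorem update_out : update (conf inp aux tmp cnt val out e) .out l =
    conf inp aux tmp cnt val l e := by
  funext k; cases k <;> simp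

@[simp] theorem update_var : update (conf inp aux tmp cnt val out e) (.var i)
    (List.replicate n tick) = conf inp aux tmp cnt val out (update e i n) := by
  funext k
  cases k with
  | var j => by_cases h : j = i <;> simp [h]
  | _ => simp

@[simp] theorem update_var_nil : update (conf inp aux tmp cnt val out e) (.var i) [] =
    conf inp aux tmp cnt val out (update e i 0) :=
  update_var inp aux tmp cnt val out e i 0

end

variable {inp aux tmp cnt val out : List Γ'} {e : Fin 6 → ℕ}

/-- The program that moves the ticks on top of a stack to another one. -/
abbrev moveTicks (k k' : Reg) : StackProg Reg Γ' := loop k isTick (mv k k')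

theorem runs_val_tmp (n : ℕ) (V : List Γ') :
    RunsIn (moveTicks .val .tmp)
      (conf inp aux tmp cnt (List.replicate n tick ++ .comma :: V) out e)
      (conf inp aux (List.replicate n tick ++ tmp) cnt (.comma :: V) out e) (2 * n + 1) := by
  simpa using runsIn_moveWhile (k := Reg.val) (k' := .tmp) (by simp) tick
    (conf inp aux tmp cnt (List.replicate n tick ++ .comma :: V) out e) n (.comma :: V) rfl
    (by simp)

theorem runs_val_cnt (n : ℕ) (V : List Γ') :
    RunsIn (moveTicks .val .cnt)
      (conf inp aux tmp cnt (List.replicate n tick ++ .comma :: V) out e)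
      (conf inp aux tmp (List.replicate n tick ++ cnt) (.comma :: V) out e) (2 * n + 1) := by
  simpa using runsIn_moveWhile (k := Reg.val) (k' := .cnt) (by simp) tick
    (conf inp aux tmp cnt (List.replicate n tick ++ .comma :: V) out e) n (.comma :: V) rfl
    (by simp)

theorem runs_val_var (n : ℕ) (V : List Γ') (i : Fin 6) (hi : e i = 0) :
    RunsIn (moveTicks .val (.var i))
      (conf inp aux tmp cnt (List.replicate n tick ++ .comma :: V) out e)
      (conf inp aux tmp cnt (.comma :: V) out (update e i n)) (2 * n + 1) := by
  simpa [hi] using runsIn_moveWhile (k := Reg.val) (k' := .var i) (by simp) tick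
    (conf inp aux tmp cnt (List.replicate n tick ++ .comma :: V) out e) n (.comma :: V) rfl
    (by simp)

theorem runs_var_val (i : Fin 6) :
    RunsIn (moveTicks (.var i) .val)
      (conf inp aux tmp cnt val out e)
      (conf inp aux tmp cnt (List.replicate (e i) tick ++ val) out (update e i 0))
      (2 * e i + 1) := by
  simpa using runsIn_moveWhile (k := Reg.var i) (k' := .val) (by simp) tick
    (conf inp aux tmp cnt val out e) (e i) [] (by simp) (by simp)

theorem runs_tmp_val (n : ℕ) :
    RunsIn (moveTicks .tmp .val)
      (conf inp aux (List.replicate n tick) cnt val out e)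
      (conf inp aux [] cnt (List.replicate n tick ++ val) out e) (2 * n + 1) := by
  simpa using runsIn_moveWhile (k := Reg.tmp) (k' := .val) (by simp) tick
    (conf inp aux (List.replicate n tick) cnt val out e) n [] (by simp) (by simp)

theorem runs_tmp_var (n : ℕ) (i : Fin 6) (hi : e i = 0) :
    RunsIn (moveTicks .tmp (.var i))
      (conf inp aux (List.replicate n tick) cnt val out e)
      (conf inp aux [] cnt val out (update e i n)) (2 * n + 1) := by
  simpa [hi] using runsIn_moveWhile (k := Reg.tmp) (k' := .var i) (by simp) tick
    (conf inp aux (List.replicate n tick) cnt val out e) n [] (by simp) (by simp)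

theorem runs_aux_tmp (n : ℕ) :
    RunsIn (moveTicks .aux .tmp)
      (conf inp (List.replicate n tick) tmp cnt val out e)
      (conf inp [] (List.replicate n tick ++ tmp) cnt val out e) (2 * n + 1) := by
  simpa using runsIn_moveWhile (k := Reg.aux) (k' := .tmp) (by simp) tick
    (conf inp (List.replicate n tick) tmp cnt val out e) n [] (by simp) (by simp)

/-- The program that moves the auxiliary stack back to the input. -/
abbrev rewind : StackProg Reg Γ' := loop .aux Option.isSome (mv .aux .inp)

theorem runs_rewind :
    RunsIn rewind (conf inp aux tmp cnt val out e)
      (conf (aux.reverse ++ inp) [] tmp cnt val out e) (2 * aux.length + 1) := by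
  simpa using runsIn_moveAll (k := Reg.aux) (k' := .inp) (by simp)
    (conf inp aux tmp cnt val out e)

theorem runs_push_val (a : Γ') :
    RunsIn (push .val a) (conf inp aux tmp cnt val out e)
      (conf inp aux tmp cnt (a :: val) out e) 1 := by
  simpa using runsIn_push Reg.val a (conf inp aux tmp cnt val out e)

theorem runs_push_out (a : Γ') :
    RunsIn (push .out a) (conf inp aux tmp cnt val out e)
      (conf inp aux tmp cnt val (a :: out) e) 1 := by
  simpa using runsIn_push Reg.out a (conf inp aux tmp cnt val out e)

theorem runs_pop_val (a : Γ') (V : List Γ') :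
    RunsIn (pop .val) (conf inp aux tmp cnt (a :: V) out e)
      (conf inp aux tmp cnt V out e) 1 := by
  simpa using runsIn_pop Reg.val (conf inp aux tmp cnt (a :: V) out e)

theorem runs_pop_val_tick (n : ℕ) (V : List Γ') :
    RunsIn (pop .val) (conf inp aux tmp cnt (List.replicate (n + 1) tick ++ V) out e)
      (conf inp aux tmp cnt (List.replicate n tick ++ V) out e) 1 := by
  simpa [List.replicate_succ] using
    runsIn_pop Reg.val (conf inp aux tmp cnt (List.replicate (n + 1) tick ++ V) out e)

theorem runs_pop_tmp (n : ℕ) :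
    RunsIn (pop .tmp) (conf inp aux (List.replicate (n + 1) tick) cnt val out e)
      (conf inp aux (List.replicate n tick) cnt val out e) 1 := by
  simpa [List.replicate_succ] using
    runsIn_pop Reg.tmp (conf inp aux (List.replicate (n + 1) tick) cnt val out e)

theorem runs_pop_cnt (n : ℕ) :
    RunsIn (pop .cnt) (conf inp aux tmp (List.replicate (n + 1) tick) val out e)
      (conf inp aux tmp (List.replicate n tick) val out e) 1 := by
  simpa [List.replicate_succ] using
    runsIn_pop Reg.cnt (conf inp aux tmp (List.replicate (n + 1) tick) val out e)

theorem runs_pop_var (i : Fin 6) :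
    RunsIn (pop (.var i)) (conf inp aux tmp cnt val out e)
      (conf inp aux tmp cnt val out (update e i (e i - 1))) 1 := by
  simpa using runsIn_pop (Reg.var i) (conf inp aux tmp cnt val out e)

end Reg

end

/-! ### Arithmetic and access to the input in polynomial time. -/

section

open Computability

namespace Reg

open Function StackProg

variable {inp aux tmp cnt val out : List Γ'} {e : Fin 6 → ℕ}

/-- The program that puts a copy of the ticks of `tmp` on the stack of values. -/
def copyTmp : StackProg Reg Γ' :=
  seq (loop .tmp Option.isSome (seq (mv .tmp .aux) (push .val tick))) (moveTicks .aux .tmp)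

theorem runs_copyTmp (b : ℕ) :
    RunsIn copyTmp (conf inp [] (List.replicate b tick) cnt val out e)
      (conf inp [] (List.replicate b tick) cnt (List.replicate b tick ++ val) out e)
      (5 * b + 2) := by
  have h := runsIn_loop (c := seq (mv .tmp .aux) (push .val tick)) (k := Reg.tmp)
    (p := Option.isSome) (T := 2)
    (fun i => conf inp (List.replicate (b - i) tick) (List.replicate i tick) cnt
      (List.replicate (b - i) tick ++ val) out e) b (by simp)
    (fun i _ => by simp) (fun i hi => by
      have e1 : b - i = b - (i + 1) + 1 := by omega
      rw [e1]
      have h1 := runsIn_mv (k := Reg.tmp) (k' := .aux)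
        (s := conf inp (List.replicate (b - (i + 1)) tick) (List.replicate (i + 1) tick) cnt
          (List.replicate (b - (i + 1)) tick ++ val) out e) (a := tick) (l := List.replicate i tick)
        (by simp [List.replicate_succ])
      simp only [update_tmp, update_aux, conf_aux] at h1
      exact h1.seq (runs_push_val tick))
  simp only [Nat.sub_self, Nat.sub_zero, List.replicate_zero, List.nil_append] at h
  have h2 := h.seq (runs_aux_tmp (tmp := []) b)
  simp only [List.append_nil] at h2
  exact h2.mono (by omega)

/-- The program that exchanges a variable and the number on top of the stack of values. -/
def exchange (i : Fin 6) : StackProg Reg Γ' :=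
  seq (moveTicks .val .tmp) (seq (moveTicks (.var i) .val) (moveTicks .tmp (.var i)))

theorem runs_exchange (i : Fin 6) (n : ℕ) (V : List Γ') :
    RunsIn (exchange i) (conf inp aux [] cnt (block n ++ V) out e)
      (conf inp aux [] cnt (block (e i) ++ V) out (update e i n)) (4 * n + 2 * e i + 3) := by
  have h1 := runs_val_tmp (inp := inp) (aux := aux) (tmp := []) (cnt := cnt) (out := out) (e := e)
    n V
  have h2 := runs_var_val (inp := inp) (aux := aux) (tmp := List.replicate n tick) (cnt := cnt)
    (val := .comma :: V) (out := out) (e := e) i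
  have h3 := runs_tmp_var (inp := inp) (aux := aux) (cnt := cnt)
    (val := List.replicate (e i) tick ++ .comma :: V) (out := out) (e := update e i 0) n i (by simp)
  simp only [List.append_nil] at h1
  simp only [update_idem] at h3
  simp only [block, List.append_assoc, List.singleton_append]
  exact (h1.seq (h2.seq h3)).mono (by omega)

/-- The program that moves the number on top of the stack of values to an empty variable. -/
def store (i : Fin 6) : StackProg Reg Γ' := seq (moveTicks .val (.var i)) (pop .val)

theorem runs_store (i : Fin 6) (hi : e i = 0) (n : ℕ) (V : List Γ') :
    RunsIn (store i) (conf inp aux tmp cnt (block n ++ V) out e)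
      (conf inp aux tmp cnt V out (update e i n)) (2 * n + 2) := by
  simp only [block, List.append_assoc, List.singleton_append]
  exact ((runs_val_var n V i hi).seq (runs_pop_val _ V)).mono (by omega)

end Reg

open Function StackProg Reg

/-- The numerical functions of an object, given by its code `enc x`, and of six numbers that programs
compute in time polynomial in the length of the code and the size of the numbers. -/
def PolyFun {α : Type} (enc : α → List Γ') (f : α → (Fin 6 → ℕ) → ℕ) : Prop :=
  ∃ (c : StackProg Reg Γ') (B T : Polynomial ℕ), ∀ x e N, (enc x).length ≤ N → (∀ i, e i ≤ N) →
    f x e ≤ B.eval N ∧ ∀ V out, RunsIn c (conf (enc x) [] [] [] V out e)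
      (conf (enc x) [] [] [] (block (f x e) ++ V) out e) (T.eval N)

namespace PolyFun

variable {α : Type} {enc : α → List Γ'} {f g : α → (Fin 6 → ℕ) → ℕ}

theorem congr (hf : PolyFun enc f) (h : ∀ x e, g x e = f x e) : PolyFun enc g := by
  have : g = f := by funext x e; exact h x e
  rwa [this]

theorem zero : PolyFun enc fun _ _ => 0 :=
  ⟨push .val .comma, 0, 1, fun x e N _ _ => ⟨by simp, fun V out => by
    simpa [block] using runs_push_val Γ'.comma⟩⟩

theorem succ (hf : PolyFun enc f) : PolyFun enc fun x e => f x e + 1 := by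
  obtain ⟨c, B, T, h⟩ := hf
  refine ⟨seq c (push .val tick), B + 1, T + 1, fun x e N hx he => ?_⟩
  obtain ⟨h1, h2⟩ := h x e N hx he
  refine ⟨by simpa using h1, fun V out => ?_⟩
  have := (h2 V out).seq (runs_push_val tick)
  simpa [block, List.replicate_succ] using this

theorem const (n : ℕ) : PolyFun enc fun _ _ => n := by
  induction n with
  | zero => exact zero
  | succ n ih => exact ih.succ

/-- Moving a stack empties it, so the number travels to `tmp`, is copied from there, and is then put
back. -/
theorem var (i : Fin 6) : PolyFun enc fun _ e => e i := by
  refine ⟨seq (push .val .comma) (seq (moveTicks (.var i) .val) (seq (moveTicks .val .tmp)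
    (seq copyTmp (moveTicks .tmp (.var i))))), .X, 11 * .X + 6, fun x e N hx he => ⟨by simpa using he i,
      fun V out => ?_⟩⟩
  have h1 := runs_push_val (inp := enc x) (aux := []) (tmp := []) (cnt := []) (val := V) (out := out)
    (e := e) .comma
  have h2 := runs_var_val (inp := enc x) (aux := []) (tmp := []) (cnt := []) (val := .comma :: V)
    (out := out) (e := e) i
  have h3 := runs_val_tmp (inp := enc x) (aux := []) (tmp := []) (cnt := [])
    (out := out) (e := update e i 0) (e i) V
  have h4 := runs_copyTmp (inp := enc x) (cnt := []) (val := .comma :: V)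
    (out := out) (e := update e i 0) (e i)
  have h5 := runs_tmp_var (inp := enc x) (aux := []) (cnt := [])
    (val := List.replicate (e i) tick ++ .comma :: V)
    (out := out) (e := update e i 0) (e i) i (by simp)
  simp only [List.append_nil] at h3
  simp only [update_idem, update_eq_self] at h5
  simp only [block, List.append_assoc, List.singleton_append]
  refine (h1.seq (h2.seq (h3.seq (h4.seq h5)))).mono ?_
  have := he i
  simp only [Polynomial.eval_add, Polynomial.eval_mul, Polynomial.eval_X, Polynomial.eval_ofNat]
  omega

theorem add (hf : PolyFun enc f) (hg : PolyFun enc g) : PolyFun enc fun x e => f x e + g x e := by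
  obtain ⟨c, B, T, h⟩ := hf
  obtain ⟨c', B', T', h'⟩ := hg
  refine ⟨seq c (seq c' (seq (moveTicks .val .tmp) (seq (pop .val) (moveTicks .tmp .val)))),
    B + B', T + T' + 4 * B' + 3, fun x e N hx he => ?_⟩
  obtain ⟨h1, h2⟩ := h x e N hx he
  obtain ⟨h1', h2'⟩ := h' x e N hx he
  refine ⟨by simpa using add_le_add h1 h1', fun V out => ?_⟩
  have h3 := h2' (block (f x e) ++ V) out
  have h4 := runs_val_tmp (inp := enc x) (aux := []) (tmp := []) (cnt := [])
    (out := out) (e := e) (g x e) (block (f x e) ++ V)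
  have h5 := runs_pop_val (inp := enc x) (aux := []) (tmp := List.replicate (g x e) tick) (cnt := [])
    (out := out) (e := e) .comma (block (f x e) ++ V)
  have h6 := runs_tmp_val (inp := enc x) (aux := []) (cnt := []) (val := block (f x e) ++ V)
    (out := out) (e := e) (g x e)
  simp only [block, List.append_assoc, List.singleton_append, List.append_nil] at *
  have e1 : List.replicate (f x e + g x e) tick ++ Γ'.comma :: V =
      List.replicate (g x e) tick ++ (List.replicate (f x e) tick ++ Γ'.comma :: V) := by
    rw [← List.append_assoc, List.replicate_append_replicate, add_comm]
  rw [e1]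
  refine ((h2 V out).seq (h3.seq (h4.seq (h5.seq h6)))).mono ?_
  simp only [Polynomial.eval_add, Polynomial.eval_mul, Polynomial.eval_ofNat]
  omega

/-- Each tick of the subtrahend cancels one tick of the minuend as long as there is one. The comma
below the minuend is never removed, which gives truncated subtraction. -/
theorem sub (hf : PolyFun enc f) (hg : PolyFun enc g) : PolyFun enc fun x e => f x e - g x e := by
  obtain ⟨c, B, T, h⟩ := hf
  obtain ⟨c', B', T', h'⟩ := hg
  refine ⟨seq c (seq c' (seq (moveTicks .val .tmp) (seq (pop .val)
    (loop .tmp Option.isSome (ite .val isTick (seq (pop .tmp) (pop .val)) (pop .tmp)))))),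
    B, T + T' + 6 * B' + 3, fun x e N hx he => ?_⟩
  obtain ⟨h1, h2⟩ := h x e N hx he
  obtain ⟨h1', h2'⟩ := h' x e N hx he
  refine ⟨(Nat.sub_le _ _).trans h1, fun V out => ?_⟩
  have h3 := h2' (block (f x e) ++ V) out
  have h4 := runs_val_tmp (inp := enc x) (aux := []) (tmp := []) (cnt := [])
    (out := out) (e := e) (g x e) (block (f x e) ++ V)
  have h5 := runs_pop_val (inp := enc x) (aux := []) (tmp := List.replicate (g x e) tick) (cnt := [])
    (out := out) (e := e) .comma (block (f x e) ++ V)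
  have h6 := runsIn_loop (c := .ite .val isTick (seq (pop .tmp) (pop .val)) (pop .tmp)) (k := Reg.tmp)
    (p := Option.isSome) (T := 3)
    (fun i => conf (enc x) [] (List.replicate i tick) [] (block (f x e - (g x e - i)) ++ V) out e)
    (g x e) (by simp) (fun i _ => by simp) (fun i hi => by
      refine RunsIn.ite (T := 2) (fun hh => ?_) (fun hh => ?_)
      · rcases hn : f x e - (g x e - (i + 1)) with _ | n
        · simp [hn, block] at hh
        · have : f x e - (g x e - i) = n := by omega
          simp only [this, block, List.append_assoc]
          exact (runs_pop_tmp i).seq (runs_pop_val_tick n _)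
      · rcases hn : f x e - (g x e - (i + 1)) with _ | n
        · have : f x e - (g x e - i) = 0 := by omega
          simp only [this]
          exact (runs_pop_tmp i).mono (by omega)
        · simp [hn, block, List.replicate_succ] at hh)
  simp only [Nat.sub_zero, Nat.sub_self, List.replicate_zero] at h6
  simp only [block, List.append_assoc, List.singleton_append, List.append_nil] at *
  refine ((h2 V out).seq (h3.seq (h4.seq (h5.seq h6)))).mono ?_
  simp only [Polynomial.eval_add, Polynomial.eval_mul, Polynomial.eval_ofNat]
  omega

/-- Repeated addition: `cnt` holds the first factor and counts down while `tmp` keeps the second one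
for copying. -/
theorem mul (hf : PolyFun enc f) (hg : PolyFun enc g) : PolyFun enc fun x e => f x e * g x e := by
  obtain ⟨c, B, T, h⟩ := hf
  obtain ⟨c', B', T', h'⟩ := hg
  refine ⟨seq c (seq c' (seq (moveTicks .val .tmp) (seq (pop .val) (seq (moveTicks .val .cnt)
    (seq (loop .cnt Option.isSome (seq (pop .cnt) copyTmp))
    (loop .tmp Option.isSome (pop .tmp))))))),
    B * B', T + T' + 4 * B' + 2 * B + B * (5 * B' + 4) + 5, fun x e N hx he => ?_⟩
  obtain ⟨h1, h2⟩ := h x e N hx he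
  obtain ⟨h1', h2'⟩ := h' x e N hx he
  refine ⟨by simpa using Nat.mul_le_mul h1 h1', fun V out => ?_⟩
  have h3 := h2' (block (f x e) ++ V) out
  have h4 := runs_val_tmp (inp := enc x) (aux := []) (tmp := []) (cnt := [])
    (out := out) (e := e) (g x e) (block (f x e) ++ V)
  have h5 := runs_pop_val (inp := enc x) (aux := []) (tmp := List.replicate (g x e) tick) (cnt := [])
    (out := out) (e := e) .comma (block (f x e) ++ V)
  have h6 := runs_val_cnt (inp := enc x) (aux := []) (tmp := List.replicate (g x e) tick) (cnt := [])
    (out := out) (e := e) (f x e) V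
  have h7 := runsIn_loop (c := seq (pop .cnt) copyTmp) (k := Reg.cnt)
    (p := Option.isSome) (T := 5 * g x e + 3)
    (fun i => conf (enc x) [] (List.replicate (g x e) tick) (List.replicate i tick)
      (block ((f x e - i) * g x e) ++ V) out e)
    (f x e) (by simp) (fun i _ => by simp) (fun i hi => by
      have h8 := runs_copyTmp (inp := enc x) (cnt := List.replicate i tick)
        (val := block ((f x e - (i + 1)) * g x e) ++ V) (out := out) (e := e) (g x e)
      have e1 : (f x e - i) * g x e = g x e + (f x e - (i + 1)) * g x e := by
        rw [show f x e - i = f x e - (i + 1) + 1 by omega]; ring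
      rw [e1]
      have e2 : List.replicate (g x e) tick ++ (block ((f x e - (i + 1)) * g x e) ++ V) =
          block (g x e + (f x e - (i + 1)) * g x e) ++ V := by
        simp only [block, List.replicate_add, List.append_assoc]
      rw [e2] at h8
      exact ((runs_pop_cnt i).seq h8).mono (by omega))
  have h8 := runsIn_clear .tmp (conf (enc x) [] (List.replicate (g x e) tick) []
    (block (f x e * g x e) ++ V) out e)
  simp only [Nat.sub_zero, Nat.sub_self, List.replicate_zero, Nat.zero_mul, conf_tmp, update_tmp,
    List.length_replicate] at h7 h8
  simp only [block, List.append_assoc, List.singleton_append, List.append_nil,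
    List.replicate_zero, List.nil_append] at *
  refine ((h2 V out).seq (h3.seq (h4.seq (h5.seq (h6.seq (h7.seq h8)))))).mono ?_
  have h9 : f x e * (5 * g x e + 3 + 1) ≤ B.eval N * (5 * B'.eval N + 4) :=
    Nat.mul_le_mul h1 (by omega)
  simp only [Polynomial.eval_add, Polynomial.eval_mul, Polynomial.eval_ofNat]
  omega

/-- The length of the code. -/
theorem length : PolyFun enc fun x _ => (enc x).length := by
  refine ⟨seq (push .val .comma) (seq (loop .inp Option.isSome (seq (mv .inp .aux) (push .val tick)))
    rewind), .X, 5 * .X + 3, fun x e N hx he => ⟨by simpa using hx, fun V out => ?_⟩⟩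
  have h1 := runs_push_val (inp := enc x) (aux := []) (tmp := []) (cnt := []) (val := V) (out := out)
    (e := e) .comma
  have h2 := runsIn_loop (c := seq (mv .inp .aux) (push .val tick)) (k := Reg.inp)
    (p := Option.isSome) (T := 2)
    (fun i => conf ((enc x).drop ((enc x).length - i)) ((enc x).take ((enc x).length - i)).reverse
      [] [] (List.replicate ((enc x).length - i) tick ++ .comma :: V) out e) (enc x).length (by simp)
    (fun i hi => by
      rw [conf_inp, List.drop_eq_getElem_cons (by omega)]; rfl) (fun i hi => by
      have e1 : (enc x).length - i = (enc x).length - (i + 1) + 1 := by omega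
      have h1 := runsIn_mv (k := Reg.inp) (k' := .aux)
        (s := conf ((enc x).drop ((enc x).length - (i + 1)))
          ((enc x).take ((enc x).length - (i + 1))).reverse
          [] [] (List.replicate ((enc x).length - (i + 1)) tick ++ .comma :: V) out e)
        (by rw [conf_inp, List.drop_eq_getElem_cons (by omega)])
      simp only [update_inp, update_aux, conf_aux] at h1
      rw [e1, List.take_succ_eq_append_getElem (by omega), List.reverse_append, List.replicate_succ]
      exact h1.seq (runs_push_val tick))
  have h3 := runs_rewind (inp := []) (aux := (enc x).reverse) (tmp := []) (cnt := [])
    (val := List.replicate (enc x).length tick ++ .comma :: V) (out := out) (e := e)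
  simp only [Nat.sub_zero, Nat.sub_self, List.replicate_zero, List.nil_append, List.drop_zero,
    List.take_zero, List.reverse_nil, List.drop_length, List.take_length, List.reverse_reverse,
    List.append_nil, List.length_reverse] at h2 h3
  simp only [block, List.append_assoc, List.singleton_append]
  refine (h1.seq (h2.seq h3)).mono ?_
  simp only [Polynomial.eval_add, Polynomial.eval_mul, Polynomial.eval_X, Polynomial.eval_ofNat]
  omega

/-- A test of the symbol of the code at a given position. -/
theorem symbol (p : Option Γ' → Bool) (hf : PolyFun enc f) :
    PolyFun enc fun x e => (p (enc x)[f x e]?).toNat := by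
  obtain ⟨c, B, T, h⟩ := hf
  refine ⟨seq c (seq (loop .val isTick (seq (pop .val) (mv .inp .aux)))
    (ite .inp p (seq rewind (push .val tick)) rewind)), 1, T + 3 * B + 2 * .X + 4,
    fun x e N hx he => ?_⟩
  obtain ⟨h1, h2⟩ := h x e N hx he
  refine ⟨by simpa using Bool.toNat_le _, fun V out => ?_⟩
  have h3 := runsIn_loop (c := seq (pop .val) (mv .inp .aux)) (k := Reg.val)
    (p := isTick) (T := 2)
    (fun i => conf ((enc x).drop (f x e - i)) ((enc x).take (f x e - i)).reverse
      [] [] (block i ++ V) out e) (f x e) (by simp [block])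
    (fun i hi => by simp [block, List.replicate_succ]) (fun i hi => by
      have h0 := runs_pop_val_tick (inp := (enc x).drop (f x e - (i + 1)))
        (aux := ((enc x).take (f x e - (i + 1))).reverse) (tmp := []) (cnt := []) (out := out) (e := e)
        i (.comma :: V)
      simp only [block, List.append_assoc, List.singleton_append]
      refine h0.seq (T' := 1) ?_
      have e1 : f x e - i = f x e - (i + 1) + 1 := by omega
      rw [e1]
      rcases lt_or_ge (f x e - (i + 1)) (enc x).length with hlt | hge
      · have h1 := runsIn_mv (k := Reg.inp) (k' := .aux)
          (s := conf ((enc x).drop (f x e - (i + 1)))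
          ((enc x).take (f x e - (i + 1))).reverse
          [] [] (List.replicate i tick ++ .comma :: V) out e)
          (by rw [conf_inp, List.drop_eq_getElem_cons hlt])
        simp only [update_inp, update_aux, conf_aux] at h1
        rw [List.take_succ_eq_append_getElem hlt, List.reverse_append]
        exact h1
      -- Beyond the end of the code `mv` does nothing, in accordance with the value `none` of a list
      -- outside its range.
      · have e2 : (enc x).drop (f x e - (i + 1)) = [] := List.drop_eq_nil_of_le hge
        have e3 : (enc x).drop (f x e - (i + 1) + 1) = [] := List.drop_eq_nil_of_le (by omega)
        rw [e2, e3, List.take_of_length_le hge, List.take_of_length_le (by omega)]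
        exact ⟨1, le_rfl, .mv_nil rfl⟩)
  have h4 := runs_rewind (inp := (enc x).drop (f x e)) (aux := ((enc x).take (f x e)).reverse)
    (tmp := []) (cnt := []) (val := .comma :: V) (out := out) (e := e)
  have hl : ((enc x).take (f x e)).length ≤ N := (List.length_take_le' _ _).trans hx
  simp only [Nat.sub_zero, Nat.sub_self, List.drop_zero, List.take_zero, List.reverse_nil,
    List.reverse_reverse, List.take_append_drop, List.length_reverse, block, List.replicate_zero,
    List.nil_append, List.append_assoc, List.singleton_append] at *
  have h5 := RunsIn.ite (k := Reg.inp) (p := p) (c := seq rewind (push .val tick)) (d := rewind)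
    (s := conf ((enc x).drop (f x e)) ((enc x).take (f x e)).reverse [] [] (.comma :: V) out e)
    (s' := conf (enc x) [] [] []
      (List.replicate (p (enc x)[f x e]?).toNat tick ++ .comma :: V) out e)
    (T := 2 * N + 2) (fun hp => by
      rw [conf_inp, List.head?_drop] at hp
      rw [hp]
      exact (h4.seq (runs_push_val tick)).mono (by omega)) (fun hp => by
      rw [conf_inp, List.head?_drop] at hp
      rw [hp]
      exact h4.mono (by omega))
  refine ((h2 V out).seq (h3.seq h5)).mono ?_
  simp only [Polynomial.eval_add, Polynomial.eval_mul, Polynomial.eval_X, Polynomial.eval_ofNat]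
  omega

end PolyFun

end

/-! ### Bounded recursion, decidable predicates and written strings. -/

section

open Computability

namespace Reg

open Function StackProg

variable {inp aux tmp cnt val out : List Γ'} {e : Fin 6 → ℕ}

/-- The program that removes the number on top of the stack of values. -/
def discard : StackProg Reg Γ' := seq (loop .val isTick (pop .val)) (pop .val)

theorem runs_discard (n : ℕ) (V : List Γ') :
    RunsIn discard (conf inp aux tmp cnt (block n ++ V) out e)
      (conf inp aux tmp cnt V out e) (2 * n + 2) := by
  have h := runsIn_loop (c := pop .val) (k := Reg.val) (p := isTick) (T := 1)
    (fun i => conf inp aux tmp cnt (block i ++ V) out e) n (by simp [block])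
    (fun i _ => by simp [block, List.replicate_succ]) (fun i hi => by
      simp only [block, List.append_assoc]
      exact runs_pop_val_tick i _)
  exact (h.seq (runs_pop_val .comma V)).mono (by omega)

end Reg

open Function StackProg Reg

namespace PolyFun

variable {α : Type} {enc : α → List Γ'} {f g a : α → (Fin 6 → ℕ) → ℕ}

/-- Recursion over the numbers below a bound in descending order, where variable `k` holds the number
and variable `5` the intermediate result, which has to stay polynomially bounded. -/
theorem foldr {k : Fin 6} (hk : k ≠ 5) (ha : PolyFun enc a) (hg : PolyFun enc g) (P : Polynomial ℕ)
    (hP : ∀ x e N, (enc x).length ≤ N → (∀ i, e i ≤ N) → ∀ j ≤ a x e,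
      (List.range' j (a x e - j)).foldr (fun j y => g x (update (update e k j) 5 y)) 0 ≤ P.eval N) :
    PolyFun enc fun x e =>
      (List.range (a x e)).foldr (fun j y => g x (update (update e k j) 5 y)) 0 := by
  obtain ⟨c, B, T, h⟩ := ha
  obtain ⟨c', B', T', h'⟩ := hg
  refine ⟨seq c (seq (exchange k) (seq (push .val .comma) (seq (exchange 5)
    (seq (loop (.var k) Option.isSome (seq (pop (.var k)) (seq c' (seq (exchange 5) discard))))
    (seq (exchange 5) (seq (moveTicks .val .tmp) (seq (pop .val)
      (seq (moveTicks .val (.var k)) (moveTicks .tmp .val))))))))), P,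
    T + 4 * B + 10 * .X + B * (T'.comp (.X + B + P) + 8 * P + 7) + 8 * P + 20,
    fun x e N hx he => ?_⟩
  have hP' := hP x e N hx he
  set G : ℕ → ℕ → ℕ := fun j y => g x (update (update e k j) 5 y)
  set F : ℕ → ℕ := fun j => (List.range' j (a x e - j)).foldr G 0 with hF
  have hF0 : (List.range (a x e)).foldr G 0 = F 0 := by simp [hF, List.range_eq_range']
  have hFa : F (a x e) = 0 := by simp [hF]
  have hFs : ∀ j < a x e, F j = G j (F (j + 1)) := by
    intro j hj
    simp only [hF]
    rw [show a x e - j = a x e - (j + 1) + 1 by omega, List.range'_succ]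
    rfl
  obtain ⟨h1, h2⟩ := h x e N hx he
  change (List.range (a x e)).foldr G 0 ≤ _ ∧ ∀ V out, RunsIn _ _
    (conf (enc x) [] [] [] (block ((List.range (a x e)).foldr G 0) ++ V) out e) _
  rw [hF0]
  refine ⟨hP' 0 (Nat.zero_le _), fun V out => ?_⟩
  -- The body runs with a counter up to `B.eval N` and an intermediate result up to `P.eval N` in
  -- its variables, so its cost is measured at `N'`.
  set N' := N + B.eval N + P.eval N with hN'
  have r1 := runs_exchange (inp := enc x) (aux := []) (cnt := []) (out := out) (e := e) k (a x e) V
  have r2 := runs_push_val (inp := enc x) (aux := []) (tmp := []) (cnt := []) (out := out)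
    (val := block (e k) ++ V) (e := update e k (a x e)) .comma
  have r3 := runs_exchange (inp := enc x) (aux := []) (cnt := []) (out := out)
    (e := update e k (a x e)) 5 0 (block (e k) ++ V)
  have r4 := runsIn_loop (c := seq (pop (.var k)) (seq c' (seq (exchange 5) discard)))
    (k := Reg.var k) (p := Option.isSome) (T := T'.eval N' + 8 * P.eval N + 6)
    (fun j => conf (enc x) [] [] [] (block (e 5) ++ (block (e k) ++ V)) out
      (update (update e k j) 5 (F j))) (a x e) (by simp [hk])
    (fun j hj => by simp [hk, List.replicate_succ]) (fun j hj => by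
      have q1 := runs_pop_var (inp := enc x) (aux := []) (tmp := []) (cnt := [])
        (val := block (e 5) ++ (block (e k) ++ V)) (out := out)
        (e := update (update e k (j + 1)) 5 (F (j + 1))) k
      rw [update_of_ne hk, update_self, Nat.add_sub_cancel, update_comm hk.symm, update_idem] at q1
      obtain ⟨-, q2⟩ := h' x (update (update e k j) 5 (F (j + 1))) N' (by omega) (by
        intro i
        by_cases hi : i = 5
        · subst hi
          rw [update_self]
          have : F (j + 1) ≤ P.eval N := hP' (j + 1) hj
          omega
        · rw [update_of_ne hi]
          by_cases hi : i = k
          · subst hi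
            rw [update_self]
            omega
          · rw [update_of_ne hi]
            have := he i
            omega)
      have q2 := q2 (block (e 5) ++ (block (e k) ++ V)) out
      have q3 := runs_exchange (inp := enc x) (aux := []) (cnt := []) (out := out)
        (e := update (update e k j) 5 (F (j + 1))) 5 (F j) (block (e 5) ++ (block (e k) ++ V))
      have q4 := runs_discard (inp := enc x) (aux := []) (tmp := []) (cnt := []) (out := out)
        (e := update (update e k j) 5 (F j)) (F (j + 1)) (block (e 5) ++ (block (e k) ++ V))
      have q5 : g x (update (update e k j) 5 (F (j + 1))) = F j := (hFs j hj).symm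
      rw [q5] at q2
      rw [update_self, update_idem] at q3
      refine (q1.seq (q2.seq (q3.seq q4))).mono ?_
      have b1 : F j ≤ P.eval N := hP' j hj.le
      have b2 : F (j + 1) ≤ P.eval N := hP' (j + 1) hj
      omega)
  have r5 := runs_exchange (inp := enc x) (aux := []) (cnt := []) (out := out)
    (e := update (update e k 0) 5 (F 0)) 5 (e 5) (block (e k) ++ V)
  have r6 := runs_val_tmp (inp := enc x) (aux := []) (tmp := []) (cnt := [])
    (out := out) (e := update e k 0) (F 0) (block (e k) ++ V)
  have r7 := runs_pop_val (inp := enc x) (aux := []) (tmp := List.replicate (F 0) tick) (cnt := [])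
    (out := out) (e := update e k 0) .comma (block (e k) ++ V)
  have r8 := runs_val_var (inp := enc x) (aux := []) (tmp := List.replicate (F 0) tick) (cnt := [])
    (out := out) (e := update e k 0) (e k) V k (by simp)
  have r9 := runs_tmp_val (inp := enc x) (aux := []) (cnt := []) (val := .comma :: V)
    (out := out) (e := e) (F 0)
  have e1 : update (update e k 0) 5 (e 5) = update e k 0 := by
    rw [update_comm hk, update_eq_self]
  simp only [hFa, hk.symm, ne_eq, not_false_eq_true, update_of_ne, update_self, update_idem,
    update_eq_self, e1, List.append_nil] at r1 r2 r3 r4 r5 r6 r7 r8 r9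
  simp only [block, List.append_assoc, List.singleton_append, List.replicate_zero,
    List.nil_append] at *
  refine ((h2 V out).seq (r1.seq (r2.seq (r3.seq (r4.seq (r5.seq (r6.seq (r7.seq
    (r8.seq r9))))))))).mono ?_
  have b1 : a x e * (T'.eval N' + 8 * P.eval N + 6 + 1) ≤
      B.eval N * (T'.eval N' + 8 * P.eval N + 7) := Nat.mul_le_mul h1 (by omega)
  have b2 := hP' 0 (Nat.zero_le _)
  have b3 := he k
  have b4 := he 5
  simp only [Polynomial.eval_add, Polynomial.eval_mul, Polynomial.eval_X, Polynomial.eval_ofNat,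
    Polynomial.eval_comp, ← hN']
  change F 0 ≤ _ at b2
  omega

/-- Sums over the numbers below a bound, where variable `k` holds the number. -/
theorem sum (k : Fin 6) (hk : k ≠ 5) {b : α → (Fin 6 → ℕ) → ℕ → ℕ} (ha : PolyFun enc a)
    (hb : PolyFun enc fun x e => b x e (e k))
    (hbe : ∀ x e j y, b x (update (update e k j) 5 y) j = b x e j) :
    PolyFun enc fun x e => ∑ j ∈ Finset.range (a x e), b x e j := by
  have hg : PolyFun enc fun x e => e 5 + b x e (e k) := (var 5).add hb
  -- By `hbe`, the summand sees the index only through its last argument and does not depend on the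
  -- accumulator in variable `5`.
  have key : ∀ x e, (fun j y => update (update e k j) 5 y 5 +
      b x (update (update e k j) 5 y) (update (update e k j) 5 y k)) = fun j y => y + b x e j := by
    intro x e
    funext j y
    rw [update_self, update_of_ne hk, update_self, hbe]
  have hl : ∀ x e (l : List ℕ), l.foldr (fun j y => y + b x e j) 0 = (l.map (b x e)).sum := by
    intro x e l
    induction l with
    | nil => rfl
    | cons j l ih => simp [ih, add_comm]
  have hs : ∀ x e n, ((List.range n).map (b x e)).sum = ∑ j ∈ Finset.range n, b x e j := by
    intro x e n
    induction n with
    | zero => rfl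
    | succ n ih => simp [List.range_succ, Finset.sum_range_succ, ih]
  have ⟨_, B, _, hB⟩ := ha
  have ⟨_, B', _, hB'⟩ := hb
  refine (foldr hk ha hg (B * B'.comp (.X + B)) ?_).congr fun x e => ?_
  · intro x e N hx he j hj
    have h1 := (hB x e N hx he).1
    rw [key, hl]
    have : ∀ y ∈ (List.range' j (a x e - j)).map (b x e), y ≤ (B'.comp (.X + B)).eval N := by
      intro y hy
      obtain ⟨q, hq, rfl⟩ := List.mem_map.1 hy
      rw [List.mem_range'_1] at hq
      have h2 := (hB' x (update e k q) (N + B.eval N) (by omega) (fun i => by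
        by_cases hi : i = k
        · subst hi; rw [update_self]; omega
        · rw [update_of_ne hi]; have := he i; omega)).1
      have h3 : b x (update e k q) q = b x e q := by
        have := hbe x e q (e 5)
        rwa [update_comm hk, update_eq_self] at this
      simp only [update_self, h3] at h2
      simpa using h2
    refine (List.sum_le_card_nsmul _ _ this).trans ?_
    simp only [List.length_map, List.length_range', smul_eq_mul, Polynomial.eval_mul]
    exact Nat.mul_le_mul (by omega) le_rfl
  · rw [key, hl, hs]

end PolyFun

/-- A predicate that is decidable in the sense of `PolyFun`. -/
def PolyPred {α : Type} (enc : α → List Γ') (P : α → (Fin 6 → ℕ) → Prop) : Prop :=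
  PolyFun enc fun x e => open scoped Classical in if P x e then 1 else 0

namespace PolyPred

open scoped Classical

variable {α : Type} {enc : α → List Γ'} {f g a : α → (Fin 6 → ℕ) → ℕ}
  {P Q : α → (Fin 6 → ℕ) → Prop}

theorem congr (hP : PolyPred enc P) (h : ∀ x e, Q x e ↔ P x e) : PolyPred enc Q :=
  PolyFun.congr hP fun x e => by simp [h]

theorem not (hP : PolyPred enc P) : PolyPred enc fun x e => ¬ P x e :=
  ((PolyFun.const 1).sub hP).congr fun x e => by by_cases h : P x e <;> simp [h]

theorem and (hP : PolyPred enc P) (hQ : PolyPred enc Q) : PolyPred enc fun x e => P x e ∧ Q x e :=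
  (hP.mul hQ).congr fun x e => by by_cases h : P x e <;> by_cases h' : Q x e <;> simp [h, h']

theorem or (hP : PolyPred enc P) (hQ : PolyPred enc Q) : PolyPred enc fun x e => P x e ∨ Q x e :=
  (hP.not.and hQ.not).not.congr fun x e => by tauto

theorem le (hf : PolyFun enc f) (hg : PolyFun enc g) : PolyPred enc fun x e => f x e ≤ g x e :=
  ((PolyFun.const 1).sub (hf.sub hg)).congr fun x e => by
    split_ifs with h <;> omega

theorem lt (hf : PolyFun enc f) (hg : PolyFun enc g) : PolyPred enc fun x e => f x e < g x e :=
  (le hf.succ hg).congr fun _ _ => Iff.rfl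

theorem eq (hf : PolyFun enc f) (hg : PolyFun enc g) : PolyPred enc fun x e => f x e = g x e :=
  ((le hf hg).and (le hg hf)).congr fun x e => by omega

theorem symbol (s : Γ') (hf : PolyFun enc f) : PolyPred enc fun x e => (enc x)[f x e]? = some s :=
  (PolyFun.symbol (fun o => decide (o = some s)) hf).congr fun x e => by
    by_cases h : (enc x)[f x e]? = some s <;> simp [h]

theorem indicator [∀ x e, Decidable (P x e)] (hP : PolyPred enc P) :
    PolyFun enc fun x e => if P x e then 1 else 0 :=
  PolyFun.congr hP fun x e => by by_cases h : P x e <;> simp [h]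

theorem card (k : Fin 6) (hk : k ≠ 5) {P : α → (Fin 6 → ℕ) → ℕ → Prop}
    [∀ x e j, Decidable (P x e j)] (ha : PolyFun enc a)
    (hP : PolyPred enc fun x e => P x e (e k))
    (hPe : ∀ x e j y, P x (update (update e k j) 5 y) j ↔ P x e j) :
    PolyFun enc fun x e => ((Finset.range (a x e)).filter fun j => P x e j).card :=
  (PolyFun.sum k hk (b := fun x e j => if P x e j then 1 else 0) ha hP.indicator
    (fun x e j y => by simp [hPe])).congr fun x e => by rw [Finset.card_filter]

theorem exists_lt (k : Fin 6) (hk : k ≠ 5) {P : α → (Fin 6 → ℕ) → ℕ → Prop} (ha : PolyFun enc a)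
    (hP : PolyPred enc fun x e => P x e (e k))
    (hPe : ∀ x e j y, P x (update (update e k j) 5 y) j ↔ P x e j) :
    PolyPred enc fun x e => ∃ j < a x e, P x e j :=
  (lt (PolyFun.const 0) (card k hk ha hP hPe)).congr fun x e => by
    simp [Finset.card_pos, Finset.filter_nonempty_iff]

theorem forall_lt (k : Fin 6) (hk : k ≠ 5) {P : α → (Fin 6 → ℕ) → ℕ → Prop} (ha : PolyFun enc a)
    (hP : PolyPred enc fun x e => P x e (e k))
    (hPe : ∀ x e j y, P x (update (update e k j) 5 y) j ↔ P x e j) :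
    PolyPred enc fun x e => ∀ j < a x e, P x e j :=
  (exists_lt k hk (P := fun x e j => ¬ P x e j) ha hP.not (fun x e j y => not_congr (hPe x e j y))).not.congr fun x e => by
    simp

end PolyPred

/-- The strings that programs write in time polynomial in the length of the code of an object and the
size of six numbers. -/
def PolyOut {α : Type} (enc : α → List Γ') (o : α → (Fin 6 → ℕ) → List Γ') : Prop :=
  ∃ (c : StackProg Reg Γ') (T : Polynomial ℕ), ∀ x e N, (enc x).length ≤ N → (∀ i, e i ≤ N) →
    ∀ V out, RunsIn c (conf (enc x) [] [] [] V out e)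
      (conf (enc x) [] [] [] V (o x e ++ out) e) (T.eval N)

namespace PolyOut

open scoped Classical

variable {α : Type} {enc : α → List Γ'} {a : α → (Fin 6 → ℕ) → ℕ} {o o' : α → (Fin 6 → ℕ) → List Γ'}

theorem congr (ho : PolyOut enc o) (h : ∀ x e, o' x e = o x e) : PolyOut enc o' := by
  have : o' = o := by funext x e; exact h x e
  rwa [this]

theorem single (s : Γ') : PolyOut enc fun _ _ => [s] :=
  ⟨push .out s, 1, fun x e N _ _ V out => by simpa using runs_push_out s⟩

theorem append (ho : PolyOut enc o) (ho' : PolyOut enc o') :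
    PolyOut enc fun x e => o x e ++ o' x e := by
  obtain ⟨c, T, h⟩ := ho
  obtain ⟨c', T', h'⟩ := ho'
  -- The output stack grows at its top, that is, at the front of the string; hence the second part
  -- is written first.
  refine ⟨seq c' c, T' + T, fun x e N hx he V out => ?_⟩
  have := (h' x e N hx he V out).seq (h x e N hx he V (o' x e ++ out))
  simpa using this

/-- There is no empty program; a push followed by a pop has no effect. -/
theorem nil : PolyOut enc fun _ _ => [] :=
  ⟨seq (push .val .comma) (pop .val), 2, fun x e N _ _ V out => by
    simpa using (runs_push_val Γ'.comma).seq (runs_pop_val (Γ'.comma) V)⟩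

theorem ite {P : α → (Fin 6 → ℕ) → Prop} [∀ x e, Decidable (P x e)] (hP : PolyPred enc P) (ho : PolyOut enc o)
    (ho' : PolyOut enc o') : PolyOut enc fun x e => if P x e then o x e else o' x e := by
  obtain ⟨c, B, T, h⟩ := hP
  obtain ⟨c', T', h'⟩ := ho
  obtain ⟨c'', T'', h''⟩ := ho'
  refine ⟨seq c (.ite .val isTick (seq discard c') (seq discard c'')), T + T' + T'' + 5,
    fun x e N hx he V out => ?_⟩
  refine (((h x e N hx he).2 V out).seq (RunsIn.ite (T := T'.eval N + T''.eval N + 4)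
    (s' := conf (enc x) [] [] [] V ((if P x e then o x e else o' x e) ++ out) e) ?_ ?_)).mono ?_
  · intro hh
    by_cases hp : P x e
    · simp only [hp, if_true]
      exact ((runs_discard 1 V).seq (h' x e N hx he V out)).mono (by omega)
    · simp [hp, block] at hh
  · intro hh
    by_cases hp : P x e
    · simp [hp, block] at hh
    · simp only [hp, if_false]
      exact ((runs_discard 0 V).seq (h'' x e N hx he V out)).mono (by omega)
  · simp only [Polynomial.eval_add, Polynomial.eval_ofNat]
    omega

/-- Loops over the numbers below a bound, where variable `k` holds the number. -/
theorem flatMap (k : Fin 6) {o : α → (Fin 6 → ℕ) → ℕ → List Γ'} (ha : PolyFun enc a)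
    (ho : PolyOut enc fun x e => o x e (e k))
    (hoe : ∀ x e j, o x (update e k j) j = o x e j) :
    PolyOut enc fun x e => (List.range (a x e)).flatMap fun j => o x e j := by
  obtain ⟨c, B, T, h⟩ := ha
  obtain ⟨c', T', h'⟩ := ho
  -- The counter runs downwards, so the pieces are written from last to first, as the output stack
  -- requires.
  refine ⟨seq c (seq (exchange k) (seq (loop (.var k) Option.isSome (seq (pop (.var k)) c'))
    (store k))), T + 4 * B + 4 * .X + B * (T'.comp (.X + B) + 2) + 6, fun x e N hx he V out => ?_⟩
  obtain ⟨h1, h2⟩ := h x e N hx he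
  have r1 := runs_exchange (inp := enc x) (aux := []) (cnt := []) (out := out) (e := e) k (a x e) V
  have r2 := runsIn_loop (c := seq (pop (.var k)) c')
    (k := Reg.var k) (p := Option.isSome) (T := T'.eval (N + B.eval N) + 1)
    (fun j => conf (enc x) [] [] [] (block (e k) ++ V)
      ((List.range' j (a x e - j)).flatMap (fun j => o x e j) ++ out)
      (update e k j)) (a x e) (by simp)
    (fun j hj => by simp [List.replicate_succ]) (fun j hj => by
      have q1 := runs_pop_var (inp := enc x) (aux := []) (tmp := []) (cnt := [])
        (val := block (e k) ++ V)
        (out := (List.range' (j + 1) (a x e - (j + 1))).flatMap (fun j => o x e j) ++ out)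
        (e := update e k (j + 1)) k
      rw [update_self, Nat.add_sub_cancel, update_idem] at q1
      have q2 := h' x (update e k j) (N + B.eval N) (by omega) (fun i => by
        by_cases hi : i = k
        · subst hi; rw [update_self]; omega
        · rw [update_of_ne hi]; have := he i; omega) (block (e k) ++ V)
        ((List.range' (j + 1) (a x e - (j + 1))).flatMap (fun j => o x e j) ++ out)
      simp only [update_self, hoe, ← List.append_assoc] at q2
      rw [show a x e - j = a x e - (j + 1) + 1 by omega, List.range'_succ, List.flatMap_cons]
      exact (q1.seq q2).mono (by omega))
  have r3 := runs_store (inp := enc x) (aux := []) (tmp := []) (cnt := [])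
    (out := (List.range (a x e)).flatMap (fun j => o x e j) ++ out)
    (e := update e k 0) k (by simp) (e k) V
  simp only [Nat.sub_self, List.range'_zero, List.flatMap_nil, List.nil_append, Nat.sub_zero,
    ← List.range_eq_range', update_idem, update_eq_self] at r2 r3
  refine ((h2 V out).seq (r1.seq (r2.seq r3))).mono ?_
  have b1 : a x e * (T'.eval (N + B.eval N) + 1 + 1) ≤
      B.eval N * (T'.eval (N + B.eval N) + 2) := Nat.mul_le_mul h1 (by omega)
  have b2 := he k
  simp only [Polynomial.eval_add, Polynomial.eval_mul, Polynomial.eval_X, Polynomial.eval_ofNat,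
    Polynomial.eval_comp]
  omega

/-- A function whose code is written by a program is computed by a Turing machine in polynomial
time. -/
theorem nonempty_computableInPolyTime {β : Type} {enc' : β → List Γ'} {f : α → β}
    (h : PolyOut enc fun x _ => enc' (f x)) :
    Nonempty (Turing.TM2ComputableInPolyTime enc enc' f) := by
  obtain ⟨c, T, h⟩ := h
  -- All stacks except the output must be empty on halting, so the input is erased at the end.
  refine StackProg.nonempty_computableInPolyTime enc enc' f
    (seq c (loop .inp Option.isSome (pop .inp))) .inp .out (T + 2 * .X + 1) fun x => ?_
  have h1 := h x (fun _ => 0) (enc x).length le_rfl (fun _ => Nat.zero_le _) [] []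
  have h2 := runsIn_clear .inp (conf (enc x) [] [] [] [] (enc' (f x)) fun _ => 0)
  have e0 : (fun _ => [] : Reg → List Γ') = conf [] [] [] [] [] [] fun _ => 0 := by
    funext k; cases k <;> rfl
  simp only [e0, update_inp, update_out, conf_inp, List.append_nil] at *
  refine (h1.seq h2).mono ?_
  simp only [Polynomial.eval_add, Polynomial.eval_mul, Polynomial.eval_X, Polynomial.eval_ofNat,
    Polynomial.eval_one]
  omega

end PolyOut

end

/-! ### Minor models of complete graphs and vertex covers. -/

section

open Relation

section MinorModels

variable {V W : Type*}

/-- Chains of vertices of `V` replace walks on a subtype, so that branch sets can be enlarged or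
shrunk without transporting walks. Only the target of each step has to be required in `s`, as the
start lies there already. -/
theorem connected_induce_iff (G : SimpleGraph V) (s : Set V) :
    (G.induce s).Connected ↔
      s.Nonempty ∧ ∀ x ∈ s, ∀ y ∈ s, ReflTransGen (fun a b => G.Adj a b ∧ b ∈ s) x y := by
  constructor
  · intro h
    refine ⟨Set.nonempty_coe_sort.1 h.nonempty, fun x hx y hy => ?_⟩
    have := (SimpleGraph.reachable_iff_reflTransGen _ _).1 (h.preconnected ⟨x, hx⟩ ⟨y, hy⟩)
    exact this.lift (fun a : s => (a : V)) (fun a b hab => ⟨hab, b.2⟩)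
  · rintro ⟨hne, h⟩
    have : Nonempty s := hne.to_subtype
    refine ⟨fun x y => ?_⟩
    have key : ∀ z, ReflTransGen (fun a b => G.Adj a b ∧ b ∈ s) (x : V) z →
        ∃ hz : z ∈ s, (G.induce s).Reachable x ⟨z, hz⟩ := by
      intro z hz
      induction hz with
      | refl => exact ⟨x.2, .rfl⟩
      | tail _ hbc ih =>
        obtain ⟨hb, ih⟩ := ih
        exact ⟨hbc.2, ih.trans (SimpleGraph.Adj.reachable (G := G.induce s) hbc.1)⟩
    exact (key y (h x x.2 y y.2)).2

theorem IsMinorModel.mk_of_reflTransGen {H : SimpleGraph W} {G : SimpleGraph V} {φ : W → Set V}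
    (hd : ∀ u v, u ≠ v → Disjoint (φ u) (φ v)) (hn : ∀ v, (φ v).Nonempty)
    (hc : ∀ v, ∀ x ∈ φ v, ∀ y ∈ φ v, ReflTransGen (fun a b => G.Adj a b ∧ b ∈ φ v) x y)
    (ha : ∀ u v, H.Adj u v → ∃ x ∈ φ u, ∃ y ∈ φ v, G.Adj x y) : IsMinorModel H G φ :=
  ⟨hd, fun v => (connected_induce_iff G _).2 ⟨hn v, hc v⟩, ha⟩

namespace IsMinorModel

variable {H : SimpleGraph W} {G : SimpleGraph V} {φ : W → Set V}

theorem nonempty (h : IsMinorModel H G φ) (i : W) : (φ i).Nonempty :=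
  ((connected_induce_iff G _).1 (h.connected i)).1

theorem reflTransGen (h : IsMinorModel H G φ) {i : W} {x y : V} (hx : x ∈ φ i) (hy : y ∈ φ i) :
    ReflTransGen (fun a b => G.Adj a b ∧ b ∈ φ i) x y :=
  ((connected_induce_iff G _).1 (h.connected i)).2 x hx y hy

theorem eq_of_mem (h : IsMinorModel H G φ) {i j : W} {x : V} (hi : x ∈ φ i) (hj : x ∈ φ j) :
    i = j := by
  by_contra hij
  exact Set.disjoint_left.1 (h.disjoint i j hij) hi hj

theorem exists_adj (h : IsMinorModel H G φ) {i : W} {x y : V} (hx : x ∈ φ i) (hy : y ∈ φ i)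
    (hxy : x ≠ y) : ∃ z ∈ φ i, G.Adj x z := by
  rcases (h.reflTransGen hx hy).cases_head with rfl | ⟨z, hz, -⟩
  · exact absurd rfl hxy
  · exact ⟨z, hz.2, hz.1⟩

theorem mono {G' : SimpleGraph V} (h : IsMinorModel H G φ) (hG : G ≤ G') : IsMinorModel H G' φ :=
  .mk_of_reflTransGen h.disjoint h.nonempty
    (fun _ _ hx _ hy => (h.reflTransGen hx hy).lift id fun _ _ hab => ⟨hG hab.1, hab.2⟩)
    (fun u v huv => let ⟨x, hx, y, hy, hxy⟩ := h.adj u v huv; ⟨x, hx, y, hy, hG hxy⟩)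

/-- A branch set outside a vertex cover consists of a single vertex. -/
theorem eq_singleton (h : IsMinorModel H G φ) {X : Set V} (hX : G.IsVertexCover X) {i : W}
    (hi : ∀ x ∈ φ i, x ∉ X) {v : V} (hv : v ∈ φ i) : φ i = {v} := by
  refine Set.eq_singleton_iff_unique_mem.2 ⟨hv, fun x hx => ?_⟩
  by_contra hxv
  obtain ⟨z, hz, hxz⟩ := h.exists_adj hx hv hxv
  rcases hX hxz with h1 | h1
  exacts [hi _ hx h1, hi _ hz h1]

/-- At most one branch set of a complete minor avoids a vertex cover. -/
theorem eq_of_forall_notMem {φ : W → Set V} (h : IsMinorModel (SimpleGraph.completeGraph W) G φ)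
    {X : Set V} (hX : G.IsVertexCover X) {i j : W} (hi : ∀ x ∈ φ i, x ∉ X)
    (hj : ∀ x ∈ φ j, x ∉ X) : i = j := by
  by_contra hij
  obtain ⟨x, hx, y, hy, hxy⟩ := h.adj i j (by simpa using hij)
  rcases hX hxy with h1 | h1
  exacts [hi _ hx h1, hj _ hy h1]

/-- A complete graph that is a minor has at most one vertex more than any vertex cover. -/
theorem card_le [Fintype W] {φ : W → Set V} (h : IsMinorModel (SimpleGraph.completeGraph W) G φ)
    {X : Finset V} (hX : G.IsVertexCover (X : Set V)) : Fintype.card W ≤ X.card + 1 := by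
  classical
  -- Each branch set is sent to one of its vertices in `X`, or to `none` if it has none. The value
  -- `none` is taken at most once and accounts for the `+ 1`.
  have hc : ∀ i : W, ∃ o : Option X, (∀ x ∈ o, (x : V) ∈ φ i) ∧
      (o = none → ∀ x ∈ φ i, x ∉ (X : Set V)) := by
    intro i
    by_cases hi : ∃ x ∈ φ i, x ∈ X
    · obtain ⟨x, hx, hxX⟩ := hi
      exact ⟨some ⟨x, hxX⟩, by simpa using hx, by simp⟩
    · push Not at hi
      exact ⟨none, by simp, fun _ => hi⟩
  choose o ho ho' using hc
  have hinj : Function.Injective o := by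
    intro i j hij
    rcases hoi : o i with _ | x
    · exact h.eq_of_forall_notMem hX (ho' i hoi) (ho' j (hij ▸ hoi))
    · exact h.eq_of_mem (ho i x hoi) (ho j x (hij ▸ hoi))
  simpa using Fintype.card_le_of_injective o hinj

/-- A complete minor has a model that uses few vertices outside a given vertex cover. -/
theorem exists_sparse {φ : W → Set V} (h : IsMinorModel (SimpleGraph.completeGraph W) G φ)
    {X : Finset V} (hX : G.IsVertexCover (X : Set V)) :
    ∃ (ψ : W → Set V) (Z : Finset V), IsMinorModel (SimpleGraph.completeGraph W) G ψ ∧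
      Z.card ≤ X.card ^ 2 + 1 ∧ ∀ i, ∀ x ∈ ψ i, x ∈ X ∨ x ∈ Z := by
  classical
  -- One representative `c p q` serves for all common neighbors of `p` and `q` in the branch set of
  -- `p`. It need not depend on `i`, since `p` lies in at most one branch set.
  have hc : ∀ p q : V, ∃ c : V, ∀ i v, p ∈ φ i → v ∈ φ i → G.Adj v p → G.Adj v q →
      c ∈ φ i ∧ G.Adj c p ∧ G.Adj c q := by
    intro p q
    by_cases hpq : ∃ i v, p ∈ φ i ∧ v ∈ φ i ∧ G.Adj v p ∧ G.Adj v q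
    · obtain ⟨i, v, hp, hv, hvp, hvq⟩ := hpq
      refine ⟨v, fun j _ hj _ _ _ => ⟨?_, hvp, hvq⟩⟩
      rwa [← h.eq_of_mem hp hj]
    · exact ⟨p, fun i v h1 h2 h3 h4 => absurd ⟨i, v, h1, h2, h3, h4⟩ hpq⟩
  choose c hc using hc
  -- The branch set that avoids `X`, if there is one, is a single vertex and is kept as a whole.
  obtain ⟨Z₁, hZ₁, hZ₁'⟩ : ∃ Z₁ : Finset V, Z₁.card ≤ 1 ∧
      ∀ i, (∀ x ∈ φ i, x ∉ (X : Set V)) → ∀ x ∈ φ i, x ∈ Z₁ := by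
    by_cases hi : ∃ i, ∀ x ∈ φ i, x ∉ (X : Set V)
    · obtain ⟨i, hi⟩ := hi
      obtain ⟨v, hv⟩ := h.nonempty i
      refine ⟨{v}, by simp, fun j hj x hx => ?_⟩
      rw [h.eq_of_forall_notMem hX hj hi, h.eq_singleton hX hi hv] at hx
      simpa using hx
    · push Not at hi
      exact ⟨∅, by simp, fun i hi' => by
        obtain ⟨x, hx, hxX⟩ := hi i
        exact absurd hxX (hi' x hx)⟩
  set Z : Finset V := (X ×ˢ X).image (fun p => c p.1 p.2) ∪ Z₁ with hZ
  have hcZ : ∀ p ∈ X, ∀ q ∈ X, c p q ∈ Z := by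
    intro p hp q hq
    exact Finset.mem_union_left _ (Finset.mem_image.2 ⟨(p, q), by simp [hp, hq], rfl⟩)
  have hcard : Z.card ≤ X.card ^ 2 + 1 := by
    refine (Finset.card_union_le _ _).trans (add_le_add (Finset.card_image_le.trans ?_) hZ₁)
    rw [Finset.card_product, sq]
  set ψ : W → Set V := fun i => {x | x ∈ φ i ∧ (x ∈ X ∨ x ∈ Z)} with hψ
  have hsub : ∀ i, (∀ x ∈ φ i, x ∉ (X : Set V)) → ∀ x ∈ φ i, x ∈ ψ i := fun i hi x hx =>
    ⟨hx, Or.inr (Finset.mem_union_right _ (hZ₁' i hi x hx))⟩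
  -- a vertex outside `X` in a branch set that meets `X` has a neighbor there
  have hnb : ∀ i p v, p ∈ φ i → p ∈ X → v ∈ φ i → v ∉ X → ∃ q ∈ φ i, q ∈ X ∧ G.Adj v q := by
    intro i p v hp hpX hv hvX
    obtain ⟨q, hq, hvq⟩ := h.exists_adj hv hp (fun e => hvX (e ▸ hpX))
    exact ⟨q, hq, (hX hvq).resolve_left hvX, hvq⟩
  -- A chain may visit vertices outside `X` that `ψ i` lacks. For such an end `y`, the induction
  -- keeps instead a neighbor of `y` in `X` that is reached within `ψ i`.
  have hconn : ∀ i p y, p ∈ φ i → p ∈ X →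
      ReflTransGen (fun a b => G.Adj a b ∧ b ∈ φ i) p y →
      (y ∈ X → ReflTransGen (fun a b => G.Adj a b ∧ b ∈ ψ i) p y) ∧
      (y ∉ X → ∃ q ∈ φ i, q ∈ X ∧ G.Adj y q ∧
        ReflTransGen (fun a b => G.Adj a b ∧ b ∈ ψ i) p q) := by
    intro i p y hp hpX hy
    have hyi : ∀ y, ReflTransGen (fun a b => G.Adj a b ∧ b ∈ φ i) p y → y ∈ φ i := by
      intro y hy
      rcases hy.cases_tail with rfl | ⟨_, -, h1⟩
      exacts [hp, h1.2]
    induction hy with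
    | refl => exact ⟨fun _ => .refl, fun h1 => absurd hpX h1⟩
    | @tail b d hpb hbd ih =>
      refine ⟨fun hd => ?_, fun hd => ?_⟩
      · by_cases hb : b ∈ X
        · exact (ih.1 hb).tail ⟨hbd.1, hbd.2, Or.inl hd⟩
        · obtain ⟨q, hq, hqX, hbq, hpq⟩ := ih.2 hb
          -- The detour from `q` to `d` through `b` is replaced by the one through `c q d`.
          obtain ⟨h1, h2, h3⟩ := hc q d i b hq (hyi b hpb) hbq hbd.1
          exact (hpq.tail ⟨h2.symm, h1, Or.inr (hcZ q hqX d hd)⟩).tail ⟨h3, hbd.2, Or.inl hd⟩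
      · have hb : b ∈ X := (hX hbd.1).resolve_right hd
        exact ⟨b, hyi b hpb, hb, hbd.1.symm, ih.1 hb⟩
  have hadj : ∀ i j x y, x ∈ φ i → y ∈ φ j → y ∈ X → G.Adj x y →
      ∃ x' ∈ ψ i, ∃ y' ∈ ψ j, G.Adj x' y' := by
    intro i j x y hx hy hyX hxy
    by_cases hi : ∃ p ∈ φ i, p ∈ X
    · obtain ⟨p, hp, hpX⟩ := hi
      by_cases hxX : x ∈ X
      · exact ⟨x, ⟨hx, Or.inl hxX⟩, y, ⟨hy, Or.inl hyX⟩, hxy⟩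
      · obtain ⟨q, hq, hqX, hxq⟩ := hnb i p x hp hpX hx hxX
        -- Here `y` may belong to another branch set: `c q y` lies in that of `q`, hence of `x`, and
        -- takes over the edge from `x` to `y`.
        obtain ⟨h1, -, h3⟩ := hc q y i x hq hx hxq hxy
        exact ⟨c q y, ⟨h1, Or.inr (hcZ q hqX y hyX)⟩, y, ⟨hy, Or.inl hyX⟩, h3⟩
    · push Not at hi
      exact ⟨x, hsub i hi x hx, y, ⟨hy, Or.inl hyX⟩, hxy⟩
  refine ⟨ψ, Z, .mk_of_reflTransGen ?_ ?_ ?_ ?_, hcard, fun i x hx => hx.2⟩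
  · intro i j hij
    exact (h.disjoint i j hij).mono (fun _ hx => hx.1) (fun _ hx => hx.1)
  · intro i
    by_cases hi : ∃ p ∈ φ i, p ∈ X
    · obtain ⟨p, hp, hpX⟩ := hi
      exact ⟨p, hp, Or.inl hpX⟩
    · push Not at hi
      obtain ⟨v, hv⟩ := h.nonempty i
      exact ⟨v, hsub i hi v hv⟩
  · intro i x hx y hy
    by_cases hi : ∃ p ∈ φ i, p ∈ X
    · obtain ⟨p, hp, hpX⟩ := hi
      have h2 : ∀ q ∈ φ i, q ∈ X → ReflTransGen (fun a b => G.Adj a b ∧ b ∈ ψ i) q y := by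
        intro q hq hqX
        have h3 := hconn i q y hq hqX (h.reflTransGen hq hy.1)
        by_cases hyX : y ∈ X
        · exact h3.1 hyX
        · obtain ⟨r, -, -, hyr, h4⟩ := h3.2 hyX
          exact h4.tail ⟨hyr.symm, hy⟩
      by_cases hxX : x ∈ X
      · exact h2 x hx.1 hxX
      · obtain ⟨q, hq, hqX, hxq⟩ := hnb i p x hp hpX hx.1 hxX
        exact .head ⟨hxq, hq, Or.inl hqX⟩ (h2 q hq hqX)
    · push Not at hi
      have h1 := h.eq_singleton hX hi hx.1
      have h2 : y = x := by simpa [h1] using hy.1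
      rw [h2]
  · intro i j hij
    obtain ⟨x, hx, y, hy, hxy⟩ := h.adj i j hij
    by_cases hyX : y ∈ X
    · exact hadj i j x y hx hy hyX hxy
    · obtain ⟨y', hy', x', hx', h1⟩ :=
        hadj j i y x hy hx ((hX hxy).resolve_right hyX) hxy.symm
      exact ⟨x', hx', y', hy', h1.symm⟩

end IsMinorModel

/-- An edge between two vertices with many common neighbors outside a vertex cover does not matter
for complete minors. -/
theorem IsMinorOf.of_add_edge {G G' : SimpleGraph V} {X : Finset V}
    (hX : G.IsVertexCover (X : Set V)) {u w : V} (hu : u ∈ X)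
    (hG : ∀ a b, G'.Adj a b → G.Adj a b ∨ (a = u ∧ b = w) ∨ (a = w ∧ b = u))
    (C : Finset V) (hC : X.card ^ 2 + 2 ≤ C.card)
    (hC' : ∀ v ∈ C, v ∉ X ∧ G.Adj v u ∧ G.Adj v w)
    (h : IsMinorOf (SimpleGraph.completeGraph W) G') :
    IsMinorOf (SimpleGraph.completeGraph W) G := by
  classical
  obtain ⟨φ, hφ⟩ := h
  have hX' : G'.IsVertexCover (X : Set V) := by
    intro a b hab
    rcases hG a b hab with h1 | ⟨rfl, rfl⟩ | ⟨rfl, rfl⟩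
    exacts [hX h1, Or.inl hu, Or.inr hu]
  obtain ⟨ψ, Z, hψ, hZ, hψZ⟩ := hφ.exists_sparse hX'
  -- The thinned model uses at most `|X| ^ 2 + 1` vertices outside `X`, one fewer than `C` is known
  -- to have.
  obtain ⟨z, hz⟩ : ∃ z ∈ C, z ∉ Z := Finset.exists_mem_notMem_of_card_lt_card (by omega)
  obtain ⟨hzX, hzu, hzw⟩ := hC' z hz.1
  have hzψ : ∀ i, z ∉ ψ i := fun i hi => (hψZ i z hi).elim hzX hz.2
  -- The free vertex `z` joins the branch set of `u`, if there is one. The path `u z w` then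
  -- replaces the edge `uw`, both inside a branch set and between two of them.
  set χ : W → Set V := fun i => {x | x ∈ ψ i ∨ x = z ∧ u ∈ ψ i} with hχ
  have hψχ : ∀ i, ψ i ⊆ χ i := fun i x hx => Or.inl hx
  have hstep : ∀ i a b, a ∈ ψ i → b ∈ ψ i → G'.Adj a b →
      ReflTransGen (fun a b => G.Adj a b ∧ b ∈ χ i) a b := by
    intro i a b ha hb hab
    rcases hG a b hab with h1 | ⟨rfl, rfl⟩ | ⟨rfl, rfl⟩
    · exact .single ⟨h1, hψχ i hb⟩
    · exact (ReflTransGen.single ⟨hzu.symm, Or.inr ⟨rfl, ha⟩⟩).tail ⟨hzw, hψχ i hb⟩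
    · exact (ReflTransGen.single ⟨hzw.symm, Or.inr ⟨rfl, hb⟩⟩).tail ⟨hzu, hψχ i hb⟩
  have hreach : ∀ i a b, a ∈ ψ i → b ∈ ψ i →
      ReflTransGen (fun a b => G.Adj a b ∧ b ∈ χ i) a b := by
    intro i a b ha hb
    have key : ∀ b, ReflTransGen (fun a b => G'.Adj a b ∧ b ∈ ψ i) a b → b ∈ ψ i ∧
        ReflTransGen (fun a b => G.Adj a b ∧ b ∈ χ i) a b := by
      intro b hab
      induction hab with
      | refl => exact ⟨ha, .refl⟩
      | tail _ hbc ih => exact ⟨hbc.2, ih.2.trans (hstep i _ _ ih.1 hbc.2 hbc.1)⟩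
    exact (key b (hψ.reflTransGen ha hb)).2
  refine ⟨χ, .mk_of_reflTransGen ?_ ?_ ?_ ?_⟩
  · intro i j hij
    refine Set.disjoint_left.2 ?_
    rintro x (hx | ⟨rfl, hx⟩) (hx' | ⟨h1, hx'⟩)
    · exact hij (hψ.eq_of_mem hx hx')
    · exact hzψ i (h1 ▸ hx)
    · exact hzψ j hx'
    · exact hij (hψ.eq_of_mem hx hx')
  · exact fun i => (hψ.nonempty i).mono (hψχ i)
  · rintro i x (hx | ⟨rfl, hx⟩) y (hy | ⟨rfl, hy⟩)
    · exact hreach i x y hx hy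
    · exact (hreach i x u hx hy).tail ⟨hzu.symm, Or.inr ⟨rfl, hy⟩⟩
    · exact .head ⟨hzu, hψχ i hx⟩ (hreach i u y hx hy)
    · exact .refl
  · intro i j hij
    obtain ⟨x, hx, y, hy, hxy⟩ := hψ.adj i j hij
    rcases hG x y hxy with h1 | ⟨rfl, rfl⟩ | ⟨rfl, rfl⟩
    · exact ⟨x, hψχ i hx, y, hψχ j hy, h1⟩
    · exact ⟨z, Or.inr ⟨rfl, hx⟩, y, hψχ j hy, hzw⟩
    · exact ⟨x, hψχ i hx, z, Or.inr ⟨rfl, hy⟩, hzw.symm⟩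

/-- Simplicial vertices of small degree outside a vertex cover do not matter for complete minors. -/
theorem IsMinorModel.diff_simplicial [Fintype W] {G : SimpleGraph V} {φ : W → Set V}
    (h : IsMinorModel (SimpleGraph.completeGraph W) G φ) {X : Set V} (hX : G.IsVertexCover X)
    (D : Set V) (hDX : ∀ v ∈ D, v ∉ X)
    (hD : ∀ v ∈ D, ∀ a b, G.Adj v a → G.Adj v b → a ≠ b → G.Adj a b)
    (hdeg : ∀ v ∈ D, ∃ N : Finset V, (∀ a, G.Adj v a → a ∈ N) ∧ N.card + 1 < Fintype.card W) :
    IsMinorModel (SimpleGraph.completeGraph W) G fun i => φ i \ D := by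
  classical
  -- `D` is independent, so all neighbors of a deleted vertex survive.
  have hind : ∀ a b, a ∈ D → G.Adj a b → b ∉ D := fun a b ha hab hb =>
    (hX hab).elim (hDX a ha) (hDX b hb)
  -- a simplicial vertex has a neighbor in its branch set
  have hnb : ∀ i, ∀ v ∈ φ i, v ∈ D → ∃ p ∈ φ i, p ∉ D ∧ G.Adj v p := by
    intro i v hv hvD
    by_cases hne : ∃ y ∈ φ i, v ≠ y
    · obtain ⟨y, hy, hvy⟩ := hne
      obtain ⟨p, hp, hvp⟩ := h.exists_adj hv hy hvy
      exact ⟨p, hp, hind v p hvD hvp, hvp⟩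
    · push Not at hne
      obtain ⟨N, hN, hcard⟩ := hdeg v hvD
      exfalso
      -- Now `v` alone is its branch set, so all other branch sets contain neighbors of `v`. Being
      -- disjoint, they need more of them than the degree bound allows.
      have hex : ∀ j : W, j ≠ i → ∃ y ∈ φ j, y ∈ N := by
        intro j hj
        obtain ⟨x, hx, y, hy, hxy⟩ := h.adj i j (by simpa using hj.symm)
        exact ⟨y, hy, hN y (hne x hx ▸ hxy)⟩
      have : Nonempty V := ⟨v⟩
      choose! y hy hyN using hex
      have := Finset.card_le_card_of_injOn (s := Finset.univ.erase i) (t := N) y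
        (fun j hj => hyN j (by simpa using hj)) (fun j hj k hk hjk => by
          have h1 := hy j (by simpa using hj)
          have h2 := hy k (by simpa using hk)
          rw [hjk] at h1
          exact h.eq_of_mem h1 h2)
      rw [Finset.card_erase_of_mem (Finset.mem_univ _), Finset.card_univ] at this
      omega
  refine .mk_of_reflTransGen ?_ ?_ ?_ ?_
  · intro i j hij
    exact (h.disjoint i j hij).mono Set.sdiff_subset Set.sdiff_subset
  · intro i
    obtain ⟨v, hv⟩ := h.nonempty i
    by_cases hvD : v ∈ D
    · obtain ⟨p, hp, hpD, -⟩ := hnb i v hv hvD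
      exact ⟨p, hp, hpD⟩
    · exact ⟨v, hv, hvD⟩
  · intro i x hx y hy
    -- A chain is cut short at each vertex of `D`: the vertices before and after it are both its
    -- neighbors, hence equal or adjacent. For an end `z` in `D` the induction remembers the
    -- neighbor before it.
    have key : ∀ z, ReflTransGen (fun a b => G.Adj a b ∧ b ∈ φ i) x z →
        (z ∉ D → ReflTransGen (fun a b => G.Adj a b ∧ b ∈ φ i \ D) x z) ∧
        (z ∈ D → ∃ q, G.Adj z q ∧ ReflTransGen (fun a b => G.Adj a b ∧ b ∈ φ i \ D) x q) := by
      intro z hz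
      induction hz with
      | refl => exact ⟨fun _ => .refl, fun h1 => absurd h1 hx.2⟩
      | @tail b d _ hbd ih =>
        refine ⟨fun hd => ?_, fun hd => ?_⟩
        · by_cases hb : b ∈ D
          · obtain ⟨q, hbq, hq⟩ := ih.2 hb
            by_cases hqd : q = d
            · exact hqd ▸ hq
            · exact hq.tail ⟨hD b hb q d hbq hbd.1 hqd, hbd.2, hd⟩
          · exact (ih.1 hb).tail ⟨hbd.1, hbd.2, hd⟩
        · exact ⟨b, hbd.1.symm, ih.1 (hind d b hd hbd.1.symm)⟩
    exact (key y (h.reflTransGen hx.1 hy.1)).1 hy.2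
  · intro i j hij
    have hij' : i ≠ j := by simpa using hij
    -- An end `x` in `D` is replaced by a neighbor `p` in its own branch set; `p` and `y` are
    -- distinct neighbors of `x`, hence adjacent.
    have key : ∀ i j x y, i ≠ j → x ∈ φ i → y ∈ φ j → y ∉ D → G.Adj x y →
        ∃ x' ∈ φ i \ D, G.Adj x' y := by
      intro i j x y hij hx hy hyD hxy
      by_cases hxD : x ∈ D
      · obtain ⟨p, hp, hpD, hxp⟩ := hnb i x hx hxD
        refine ⟨p, ⟨hp, hpD⟩, hD x hxD p y hxp hxy ?_⟩
        rintro rfl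
        exact hij (h.eq_of_mem hp hy)
      · exact ⟨x, ⟨hx, hxD⟩, hxy⟩
    obtain ⟨x, hx, y, hy, hxy⟩ := h.adj i j hij
    by_cases hyD : y ∈ D
    · have hxD := hind y x hyD hxy.symm
      obtain ⟨y', hy', h1⟩ := key j i y x hij'.symm hy hx hxD hxy.symm
      exact ⟨x, ⟨hx, hxD⟩, y', hy', h1.symm⟩
    · obtain ⟨x', hx', h1⟩ := key i j x y hij' hx hy hyD hxy
      exact ⟨x', hx', y, ⟨hy, hyD⟩, h1⟩

theorem IsMinorOf.mono {H : SimpleGraph W} {G G' : SimpleGraph V} (h : IsMinorOf H G)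
    (hG : G ≤ G') : IsMinorOf H G' :=
  let ⟨φ, hφ⟩ := h
  ⟨φ, hφ.mono hG⟩

theorem IsMinorModel.comap {V' : Type*} {H : SimpleGraph W} {G : SimpleGraph V} {φ : W → Set V}
    (h : IsMinorModel H G φ) {f : V' → V}
    (hf : Function.Injective f) (hφ : ∀ i, ∀ x ∈ φ i, x ∈ Set.range f) :
    IsMinorOf H (G.comap f) := by
  refine ⟨fun i => f ⁻¹' φ i, .mk_of_reflTransGen ?_ ?_ ?_ ?_⟩
  · exact fun i j hij => (h.disjoint i j hij).preimage f
  · intro i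
    obtain ⟨v, hv⟩ := h.nonempty i
    obtain ⟨v', rfl⟩ := hφ i v hv
    exact ⟨v', hv⟩
  · intro i x hx y hy
    have key : ∀ z, ReflTransGen (fun a b => G.Adj a b ∧ b ∈ φ i) (f x) z → ∀ z', f z' = z →
        ReflTransGen (fun a b => (G.comap f).Adj a b ∧ b ∈ f ⁻¹' φ i) x z' := by
      intro z hz
      induction hz with
      | refl =>
        intro z' hz'
        rw [hf hz']
      | @tail b d hb hbd ih =>
        rintro z' rfl
        have hbi : b ∈ φ i := by
          rcases hb.cases_tail with rfl | ⟨_, -, h1⟩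
          exacts [hx, h1.2]
        obtain ⟨b', rfl⟩ := hφ i b hbi
        exact (ih b' rfl).tail hbd
    exact key (f y) (h.reflTransGen hx hy) y rfl
  · intro i j hij
    obtain ⟨x, hx, y, hy, hxy⟩ := h.adj i j hij
    obtain ⟨x', rfl⟩ := hφ i x hx
    obtain ⟨y', rfl⟩ := hφ j y hy
    exact ⟨x', hx, y', hy, hxy⟩

theorem IsMinorOf.of_comap {V' : Type*} {H : SimpleGraph W} {G : SimpleGraph V} {f : V' → V}
    (hf : Function.Injective f) (h : IsMinorOf H (G.comap f)) : IsMinorOf H G := by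
  obtain ⟨φ, h⟩ := h
  refine ⟨fun i => f '' φ i, .mk_of_reflTransGen ?_ ?_ ?_ ?_⟩
  · exact fun i j hij => (Set.disjoint_image_iff hf).2 (h.disjoint i j hij)
  · exact fun i => (h.nonempty i).image f
  · rintro i _ ⟨x, hx, rfl⟩ _ ⟨y, hy, rfl⟩
    exact (h.reflTransGen hx hy).lift f fun a b hab => ⟨hab.1, Set.mem_image_of_mem f hab.2⟩
  · intro i j hij
    obtain ⟨x, hx, y, hy, hxy⟩ := h.adj i j hij
    exact ⟨f x, Set.mem_image_of_mem f hx, f y, Set.mem_image_of_mem f hy, hxy⟩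

/-- A clique is a complete minor. -/
theorem IsMinorOf.of_clique {G : SimpleGraph V} (s : Finset V)
    (hs : ∀ a ∈ s, ∀ b ∈ s, a ≠ b → G.Adj a b) {t : ℕ} (ht : t ≤ s.card) :
    IsMinorOf (SimpleGraph.completeGraph (Fin t)) G := by
  obtain ⟨f⟩ : Nonempty (Fin t ↪ s) :=
    Function.Embedding.nonempty_of_card_le (by simpa using ht)
  refine ⟨fun i => {(f i : V)}, .mk_of_reflTransGen ?_ ?_ ?_ ?_⟩
  · intro i j hij
    simpa [Subtype.ext_iff] using fun h => hij (f.injective (Subtype.ext h))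
  · simp
  · rintro i x rfl y rfl
    exact .refl
  · intro i j hij
    refine ⟨_, rfl, _, rfl, hs _ (f i).2 _ (f j).2 fun h => ?_⟩
    exact hij (f.injective (Subtype.ext h))

end MinorModels

end

/-! ### Saturation and the reduction rules. -/

section

section Saturation

open scoped Classical

variable {V W : Type*} [Fintype V]

/-- The common neighbors of two vertices outside a set. -/
noncomputable def commonOutside (G : SimpleGraph V) (X : Finset V) (a b : V) : Finset V :=
  Finset.univ.filter fun v => v ∉ X ∧ G.Adj v a ∧ G.Adj v b

/-- The graph obtained by joining all pairs of vertices of `X` that have at least `|X| ^ 2 + 2` common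
neighbors outside `X`. -/
def saturation (G : SimpleGraph V) (X : Finset V) : SimpleGraph V where
  Adj a b := G.Adj a b ∨ a ≠ b ∧ a ∈ X ∧ b ∈ X ∧ X.card ^ 2 + 2 ≤ (commonOutside G X a b).card
  symm := ⟨fun a b h => h.imp (fun h => h.symm) fun ⟨h1, h2, h3, h4⟩ =>
    ⟨h1.symm, h3, h2, by
      have : commonOutside G X b a = commonOutside G X a b := by
        ext v; simp [commonOutside, and_comm]
      rwa [this]⟩⟩
  loopless := ⟨fun a h => h.elim (fun h => h.ne rfl) fun h => h.1 rfl⟩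

variable {G : SimpleGraph V} {X : Finset V}

theorem le_saturation (G : SimpleGraph V) (X : Finset V) : G ≤ saturation G X := fun _ _ h => Or.inl h

theorem saturation_adj_of_notMem {v a : V} (hv : v ∉ X) :
    (saturation G X).Adj v a ↔ G.Adj v a :=
  ⟨fun h => h.resolve_right fun h => hv h.2.1, fun h => Or.inl h⟩

theorem isVertexCover_saturation (hX : G.IsVertexCover (X : Set V)) :
    (saturation G X).IsVertexCover (X : Set V) := by
  rintro a b (h | h)
  exacts [hX h, Or.inl h.2.1]

/-- Saturation does not create complete minors. -/
theorem isMinorOf_saturation_iff (hX : G.IsVertexCover (X : Set V)) :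
    IsMinorOf (SimpleGraph.completeGraph W) (saturation G X) ↔
      IsMinorOf (SimpleGraph.completeGraph W) G := by
  refine ⟨fun h => ?_, fun h => h.mono (le_saturation G X)⟩
  -- The new edges are removed one at a time. Common neighbors are counted in `G`, and they remain
  -- common neighbors in every intermediate graph, for which `X` is still a vertex cover.
  have key : ∀ F : Finset (V × V), (∀ p ∈ F, p.1 ∈ X ∧ p.2 ∈ X ∧
      X.card ^ 2 + 2 ≤ (commonOutside G X p.1 p.2).card) →
      IsMinorOf (SimpleGraph.completeGraph W)
        (G ⊔ SimpleGraph.fromRel fun a b => (a, b) ∈ F) →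
      IsMinorOf (SimpleGraph.completeGraph W) G := by
    intro F
    induction F using Finset.induction_on with
    | empty =>
      intro _ h
      refine h.mono ?_
      rintro a b (h | h)
      · exact h
      · simp at h
    | insert p F hp ih =>
      intro hF h
      refine ih (fun q hq => hF q (Finset.mem_insert_of_mem hq)) ?_
      obtain ⟨h1, h2, h3⟩ := hF p (Finset.mem_insert_self _ _)
      refine IsMinorOf.of_add_edge (X := X) (u := p.1) (w := p.2) ?_ h1 ?_
        (commonOutside G X p.1 p.2) h3 ?_ h
      · rintro a b (h | h)
        · exact hX h
        · rw [SimpleGraph.fromRel_adj] at h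
          rcases h.2 with h | h
          · exact Or.inl (hF _ (Finset.mem_insert_of_mem h)).1
          · exact Or.inl (hF _ (Finset.mem_insert_of_mem h)).2.1
      · rintro a b (h | h)
        · exact Or.inl (Or.inl h)
        · simp only [SimpleGraph.fromRel_adj, Finset.mem_insert] at h
          obtain ⟨hab, (h | h) | (h | h)⟩ := h
          · exact Or.inr (Or.inl ⟨congrArg Prod.fst h, congrArg Prod.snd h⟩)
          · exact Or.inl (Or.inr ⟨hab, Or.inl h⟩)
          · exact Or.inr (Or.inr ⟨congrArg Prod.snd h, congrArg Prod.fst h⟩)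
          · exact Or.inl (Or.inr ⟨hab, Or.inr h⟩)
      · intro v hv
        simp only [commonOutside, Finset.mem_filter] at hv
        exact ⟨hv.2.1, Or.inl hv.2.2.1, Or.inl hv.2.2.2⟩
  refine key (Finset.univ.filter fun p => p.1 ∈ X ∧ p.2 ∈ X ∧
      X.card ^ 2 + 2 ≤ (commonOutside G X p.1 p.2).card) (fun p hp => by simpa using hp)
    (h.mono ?_)
  rintro a b (h | h)
  · exact Or.inl h
  · exact Or.inr ⟨h.1, Or.inl (by simpa using h.2)⟩

/-- The vertices outside `X` whose neighbors are pairwise adjacent after saturation. -/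
def IsRemovable (G : SimpleGraph V) (X : Finset V) (v : V) : Prop :=
  v ∉ X ∧ ∀ a b, G.Adj v a → G.Adj v b → a ≠ b → (saturation G X).Adj a b

/-- A vertex outside `X` that is not removable has two distinct neighbors that stay nonadjacent
after saturation, and both lie in the vertex cover. Such a pair has at most `|X| ^ 2 + 1` common
neighbors outside `X`, since otherwise it would have been joined. -/
theorem card_filter_not_isRemovable_le (hX : G.IsVertexCover (X : Set V)) :
    (Finset.univ.filter fun v => ¬ IsRemovable G X v).card ≤
      X.card + X.card ^ 2 * (X.card ^ 2 + 1) := by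
  set P := (X ×ˢ X).filter fun p => p.1 ≠ p.2 ∧ ¬ (saturation G X).Adj p.1 p.2
  have hsub : (Finset.univ.filter fun v => ¬ IsRemovable G X v) ⊆
      X ∪ P.biUnion fun p => commonOutside G X p.1 p.2 := by
    intro v hv
    by_cases hvX : v ∈ X
    · exact Finset.mem_union_left _ hvX
    · simp only [Finset.mem_filter, Finset.mem_univ, true_and, IsRemovable, not_and, not_forall]
        at hv
      obtain ⟨a, b, ha, hb, hab, h⟩ := hv hvX
      refine Finset.mem_union_right _ (Finset.mem_biUnion.2 ⟨(a, b), ?_, ?_⟩)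
      · simp only [P, Finset.mem_filter, Finset.mem_product]
        exact ⟨⟨(hX ha).resolve_left hvX, (hX hb).resolve_left hvX⟩, hab, h⟩
      · simp [commonOutside, hvX, ha, hb]
  refine (Finset.card_le_card hsub).trans ((Finset.card_union_le _ _).trans ?_)
  refine Nat.add_le_add_left ((Finset.card_biUnion_le_card_mul P _ (X.card ^ 2 + 1) ?_).trans ?_) _
  · intro p hp
    simp only [P, Finset.mem_filter, Finset.mem_product] at hp
    by_contra hlt
    exact hp.2.2 (Or.inr ⟨hp.2.1, hp.1.1, hp.1.2, by omega⟩)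
  · refine Nat.mul_le_mul_right _ ((Finset.card_filter_le _ _).trans ?_)
    rw [Finset.card_product, sq]

end Saturation

/-! ### The kernel, its correctness and its size. -/

namespace CliqueMinorInstance

open scoped Classical

/-- The vertices that are not removable. -/
noncomputable def kept (I : CliqueMinorInstance) : List (Fin I.n) :=
  (List.finRange I.n).filter fun v => ¬ IsRemovable I.G I.X v

theorem kept_get_injective (I : CliqueMinorInstance) : Function.Injective I.kept.get :=
  List.nodup_iff_injective_get.1 ((List.nodup_finRange _).filter _)

theorem mem_kept (I : CliqueMinorInstance) (v : Fin I.n) :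
    v ∈ I.kept ↔ ¬ IsRemovable I.G I.X v := by
  simp [kept]

/-- A trivial instance with answer no. -/
def noInstance : CliqueMinorInstance := ⟨0, ⊥, ∅, by simp, 1, le_rfl⟩

/-- A trivial instance with answer yes. -/
def yesInstance : CliqueMinorInstance := ⟨1, ⊥, ∅, by simp, 1, le_rfl⟩

/-- The saturated graph without the removable vertices. -/
noncomputable def reduced (I : CliqueMinorInstance) : CliqueMinorInstance where
  n := I.kept.length
  G := (saturation I.G I.X).comap I.kept.get
  X := I.X.preimage I.kept.get I.kept_get_injective.injOn
  isVertexCover := by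
    intro a b hab
    simpa using isVertexCover_saturation I.isVertexCover hab
  t := I.t
  one_le_t := I.one_le_t

/-- The condition under which a removable vertex and its neighbors contain the clique. -/
def HasLargeRemovable (I : CliqueMinorInstance) : Prop :=
  ∃ v, IsRemovable I.G I.X v ∧ I.t ≤ (Finset.univ.filter fun a => I.G.Adj v a).card + 1

/-- The kernelization. -/
noncomputable def kernel (I : CliqueMinorInstance) : CliqueMinorInstance :=
  if I.X.card + 1 < I.t then noInstance
  else if I.HasLargeRemovable then yesInstance
  else I.reduced

/-- Does the graph contain the clique as a minor? -/
def HasMinor (I : CliqueMinorInstance) : Prop :=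
  IsMinorOf (SimpleGraph.completeGraph (Fin I.t)) I.G

theorem not_hasMinor_noInstance : ¬ noInstance.HasMinor := by
  rintro ⟨φ, hφ⟩
  obtain ⟨v, -⟩ := hφ.nonempty (⟨0, Nat.one_pos⟩ : Fin 1)
  exact Fin.elim0 v

theorem hasMinor_yesInstance : yesInstance.HasMinor :=
  .of_clique (G := (⊥ : SimpleGraph (Fin 1))) (t := 1) Finset.univ
    (fun a _ b _ hab => absurd (Subsingleton.elim a b) hab) (by simp)

/-- If no removable vertex is large, all of them are simplicial of degree less than `t - 1` in the
saturation. They can then be dropped from any model simultaneously, and the rest of the model lives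
on the kept vertices. -/
theorem hasMinor_reduced_iff (I : CliqueMinorInstance) (h : ¬ I.HasLargeRemovable) :
    I.reduced.HasMinor ↔ I.HasMinor := by
  refine Iff.trans ⟨fun h' => ?_, ?_⟩ (isMinorOf_saturation_iff I.isVertexCover)
  · exact IsMinorOf.of_comap (f := I.kept.get) I.kept_get_injective h'
  · rintro ⟨φ, hφ⟩
    have h1 := hφ.diff_simplicial (isVertexCover_saturation I.isVertexCover)
      {v | IsRemovable I.G I.X v} (fun v hv => hv.1) (fun v hv a b ha hb => by
        rw [saturation_adj_of_notMem hv.1] at ha hb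
        exact hv.2 a b ha hb) (fun v hv => by
        refine ⟨Finset.univ.filter fun a => I.G.Adj v a, fun a ha => ?_, ?_⟩
        · rw [saturation_adj_of_notMem hv.1] at ha
          simpa using ha
        · rw [Fintype.card_fin]
          by_contra hlt
          exact h ⟨v, hv, by omega⟩)
    refine h1.comap (f := I.kept.get) I.kept_get_injective fun i x hx => ?_
    exact List.mem_iff_get.1 ((I.mem_kept x).2 hx.2)

/-- In the saturation, a large removable vertex and its neighbors form a clique with at least `t`
vertices. -/
theorem hasMinor_of_hasLargeRemovable (I : CliqueMinorInstance) (h : I.HasLargeRemovable) :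
    I.HasMinor := by
  obtain ⟨v, hv, ht⟩ := h
  refine (isMinorOf_saturation_iff I.isVertexCover).1
    (.of_clique (insert v (Finset.univ.filter fun a => I.G.Adj v a)) ?_ ?_)
  · intro a ha b hb hab
    simp only [Finset.mem_insert, Finset.mem_filter, Finset.mem_univ, true_and] at ha hb
    rcases ha with rfl | ha <;> rcases hb with rfl | hb
    · exact absurd rfl hab
    · exact Or.inl hb
    · exact Or.inl ha.symm
    · exact hv.2 a b ha hb hab
  · rwa [Finset.card_insert_of_notMem (by simp)]

theorem hasMinor_kernel_iff (I : CliqueMinorInstance) : I.kernel.HasMinor ↔ I.HasMinor := by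
  unfold kernel
  split_ifs with h1 h2
  · refine iff_of_false not_hasMinor_noInstance ?_
    rintro ⟨φ, hφ⟩
    have := hφ.card_le I.isVertexCover
    rw [Fintype.card_fin] at this
    omega
  · exact iff_of_true hasMinor_yesInstance (I.hasMinor_of_hasLargeRemovable h2)
  · exact I.hasMinor_reduced_iff h2

theorem length_kept (I : CliqueMinorInstance) :
    I.kept.length = (Finset.univ.filter fun v => ¬ IsRemovable I.G I.X v).card := by
  rw [kept, ← List.toFinset_card_of_nodup ((List.nodup_finRange _).filter _)]
  congr 1
  ext v
  simp

/-- The last `+ 1` is needed for the single vertex of `yesInstance` when `X` is empty. -/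
theorem kernel_n_le (I : CliqueMinorInstance) :
    I.kernel.n ≤ I.X.card + I.X.card ^ 2 * (I.X.card ^ 2 + 1) + 1 := by
  unfold kernel
  split_ifs with h1 h2
  · exact Nat.zero_le _
  · exact Nat.le_add_left _ _
  · have := card_filter_not_isRemovable_le I.isVertexCover
    rw [← length_kept] at this
    exact this.trans (Nat.le_succ _)

theorem kernel_X_card_le (I : CliqueMinorInstance) : I.kernel.X.card ≤ I.X.card := by
  unfold kernel
  by_cases h1 : I.X.card + 1 < I.t
  · rw [if_pos h1]
    exact Nat.zero_le _
  by_cases h2 : I.HasLargeRemovable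
  · rw [if_neg h1, if_pos h2]
    exact Nat.zero_le _
  · rw [if_neg h1, if_neg h2]
    refine Finset.card_le_card_of_injOn I.kept.get (fun i hi => ?_)
      (I.kept_get_injective.injOn)
    exact (Finset.mem_preimage (hf := I.kept_get_injective.injOn)).1 (Finset.mem_coe.1 hi)

/-- This bounds the part of the output's code that holds `t`; the size of the graph alone does not.
-/
theorem kernel_t_le (I : CliqueMinorInstance) : I.kernel.t ≤ I.X.card + 1 := by
  unfold kernel
  split_ifs with h1 h2
  · exact Nat.le_add_left _ _
  · exact Nat.le_add_left _ _
  · exact not_lt.1 h1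

end CliqueMinorInstance

end

/-! ### Positions in the encoding and binary numbers. -/

section

open Computability

section Lists

/-- This locates membership bits and matrix entries in the code of an instance, whose rows all have
length `n + 2`. -/
theorem List.getElem?_flatMap_of_length_eq {α β : Type*} {m : ℕ} {f : α → List β}
    (hf : ∀ a, (f a).length = m) (l : List α) (i : ℕ) {r : ℕ} (hr : r < m) :
    (l.flatMap f)[i * m + r]? = l[i]?.bind fun a => (f a)[r]? := by
  induction l generalizing i with
  | nil => simp
  | cons a l ih =>
    rw [List.flatMap_cons]
    cases i with
    | zero =>
      rw [List.getElem?_append_left (by rw [hf]; omega)]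
      simp
    | succ i =>
      rw [List.getElem?_append_right (by rw [hf, Nat.succ_mul]; omega), hf,
        show (i + 1) * m + r - m = i * m + r by rw [Nat.succ_mul]; omega, ih]
      simp

theorem List.flatMap_filter_eq {α β : Type*} (p : α → Prop) [DecidablePred p] (f : α → List β)
    (l : List α) :
    (l.filter fun a => p a).flatMap f = l.flatMap fun a => if p a then f a else [] := by
  induction l with
  | nil => rfl
  | cons a l ih => by_cases h : p a <;> simp [h, ih]

theorem List.flatMap_range {β : Type*} (n : ℕ) (f : ℕ → List β) :
    (List.range n).flatMap f = (List.finRange n).flatMap fun i : Fin n => f i := by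
  rw [← List.map_coe_finRange_eq_range]
  exact List.flatMap_map ..

theorem Finset.card_filter_range (n : ℕ) (p : ℕ → Prop) [DecidablePred p] :
    ((Finset.range n).filter p).card = (Finset.univ.filter fun i : Fin n => p i).card := by
  rw [Finset.card_filter, Finset.card_filter, Finset.sum_range]

/-- `encodeNat` lists the least significant digit first, so Horner's scheme is a right fold. -/
theorem foldr_encodeNat (t : ℕ) :
    (encodeNat t).foldr (fun b y => 2 * y + b.toNat) 0 = t := by
  have h : ∀ p : PosNum, (encodePosNum p).foldr (fun b y => 2 * y + b.toNat) 0 = (p : ℕ) := by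
    intro p
    induction p with
    | one => rfl
    | bit0 p ih => rw [encodePosNum, List.foldr_cons, ih, PosNum.cast_bit0]; simp [two_mul]
    | bit1 p ih => rw [encodePosNum, List.foldr_cons, ih, PosNum.cast_bit1]; simp [two_mul]
  have h' : ∀ m : Num, (encodeNum m).foldr (fun b y => 2 * y + b.toNat) 0 = (m : ℕ) := by
    intro m
    cases m with
    | zero => rfl
    | pos p => exact h p
  exact (h' _).trans (Num.to_of_nat t)

theorem length_encodeNat_le (t : ℕ) : (encodeNat t).length ≤ t := by
  have h : ∀ p : PosNum, (encodePosNum p).length ≤ (p : ℕ) := by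
    intro p
    have h0 := fun p : PosNum => PosNum.to_nat_pos p
    induction p with
    | one => simp [encodePosNum]
    | bit0 p ih => have := h0 p; simp [encodePosNum]; omega
    | bit1 p ih => have := h0 p; simp [encodePosNum]; omega
  have h' : ∀ m : Num, (encodeNum m).length ≤ (m : ℕ) := by
    intro m
    cases m with
    | zero => simp [encodeNum]
    | pos p => exact h p
  exact (h' _).trans (Num.to_of_nat t).le

/-- Capping after every step is the same as capping once at the end, because `2 * y + b` is monotone
in `y` and never below `y`. It keeps the intermediate results small. -/
theorem foldr_min (c : ℕ) (l : List Bool) :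
    l.foldr (fun b y => min (2 * y + b.toNat) c) 0 =
      min (l.foldr (fun b y => 2 * y + b.toNat) 0) c := by
  induction l with
  | nil => simp
  | cons b l ih => simp only [List.foldr_cons, ih]; omega

end Lists

/-! ### Polynomial-time computation of the kernel. -/

namespace CliqueMinorInstance

open scoped Classical

section Decoding

variable (I : CliqueMinorInstance)

theorem length_encode :
    I.encode.length = (encodeNat I.t).length + 1 + I.n * (I.n + 2) := by
  simp [encode, encodeRow, List.length_flatMap]
  ring

theorem n_le_length_encode : I.n ≤ I.encode.length := by
  rw [length_encode]
  nlinarith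

theorem getElem?_encode_of_lt {p : ℕ} (hp : p < (encodeNat I.t).length) :
    I.encode[p]? = some (Γ'.bit (encodeNat I.t)[p]) := by
  rw [encode, List.getElem?_append_left (by simpa using hp)]
  simp [hp]

theorem getElem?_encode_length : I.encode[(encodeNat I.t).length]? = some Γ'.comma := by
  rw [encode, List.getElem?_append_right (by simp)]
  simp

theorem getElem?_encode_row (i : Fin I.n) {r : ℕ} (hr : r < I.n + 2) :
    I.encode[(encodeNat I.t).length + 1 + (i * (I.n + 2) + r)]? = (I.encodeRow i)[r]? := by
  rw [encode, List.getElem?_append_right (by simp; omega), List.length_map,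
    show (encodeNat I.t).length + 1 + (i * (I.n + 2) + r) - (encodeNat I.t).length =
      (i * (I.n + 2) + r) + 1 by omega, List.getElem?_cons_succ,
    List.getElem?_flatMap_of_length_eq (m := I.n + 2) (by simp [encodeRow]) _ _ hr]
  simp

theorem getElem?_encode_mem (i : Fin I.n) :
    I.encode[(encodeNat I.t).length + 1 + (i * (I.n + 2) + 0)]? =
      some (Γ'.bit (decide (i ∈ I.X))) := by
  rw [getElem?_encode_row I i (by omega)]
  simp [encodeRow]

theorem getElem?_encode_adj (i j : Fin I.n) :
    I.encode[(encodeNat I.t).length + 1 + (i * (I.n + 2) + (j + 1))]? =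
      some (Γ'.bit (decide (I.G.Adj i j))) := by
  rw [getElem?_encode_row I i (by omega)]
  simp [encodeRow]

end Decoding

/-- Membership of a number in the vertex cover. -/
def MemX (I : CliqueMinorInstance) (i : ℕ) : Prop := ∃ h : i < I.n, (⟨i, h⟩ : Fin I.n) ∈ I.X

/-- Adjacency of two numbers. -/
def AdjNat (I : CliqueMinorInstance) (i j : ℕ) : Prop :=
  ∃ (hi : i < I.n) (hj : j < I.n), I.G.Adj ⟨i, hi⟩ ⟨j, hj⟩

/-- Adjacency of two numbers after saturation. -/
def SatAdjNat (I : CliqueMinorInstance) (i j : ℕ) : Prop :=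
  ∃ (hi : i < I.n) (hj : j < I.n), (saturation I.G I.X).Adj ⟨i, hi⟩ ⟨j, hj⟩

/-- Removability of a number. -/
def RemovableNat (I : CliqueMinorInstance) (i : ℕ) : Prop :=
  ∃ h : i < I.n, IsRemovable I.G I.X ⟨i, h⟩

section

variable {I : CliqueMinorInstance} (i j : Fin I.n)

@[simp] theorem memX_coe : I.MemX i ↔ i ∈ I.X := by simp [MemX]

@[simp] theorem adjNat_coe : I.AdjNat i j ↔ I.G.Adj i j := by simp [AdjNat]

@[simp] theorem satAdjNat_coe : I.SatAdjNat i j ↔ (saturation I.G I.X).Adj i j := by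
  simp [SatAdjNat]

@[simp] theorem removableNat_coe : I.RemovableNat i ↔ IsRemovable I.G I.X i := by
  simp [RemovableNat]

end

open PolyFun PolyPred Function

variable {a b : CliqueMinorInstance → (Fin 6 → ℕ) → ℕ}

/-- The digits of `t` end at the first comma, so their number is that of the positions `j` such that
no comma occurs up to and including `j`. -/
theorem polyFun_length_encodeNat : PolyFun encode fun I _ => (encodeNat I.t).length := by
  refine (PolyPred.card 0 (by decide)
    (P := fun (I : CliqueMinorInstance) e j => ∀ q < j + 1, ¬ I.encode[q]? = some Γ'.comma) PolyFun.length
    (PolyPred.forall_lt 1 (by decide) (P := fun (I : CliqueMinorInstance) e q => ¬ I.encode[q]? = some Γ'.comma)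
      (PolyFun.var 0).succ (PolyPred.symbol _ (PolyFun.var 1)).not (fun _ _ _ _ => Iff.rfl))
    (fun _ _ _ _ => Iff.rfl)).congr fun I e => ?_
  have : (Finset.range I.encode.length).filter
      (fun j => ∀ q < j + 1, ¬ I.encode[q]? = some Γ'.comma) =
      Finset.range (encodeNat I.t).length := by
    ext j
    simp only [Finset.mem_filter, Finset.mem_range]
    refine ⟨fun h => ?_, fun h => ⟨by rw [length_encode]; omega, fun q hq => ?_⟩⟩
    · by_contra hj
      exact h.2 _ (by omega) I.getElem?_encode_length
    · rw [I.getElem?_encode_of_lt (by omega)]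
      simp
  rw [this, Finset.card_range]

/-- The formula `length_encode` is inverted by counting: with `j + 1` in place of `n`, its value is
at most the actual length exactly for `j < n`. -/
theorem polyFun_n : PolyFun encode fun I _ => I.n := by
  refine (PolyPred.card 0 (by decide)
    (P := fun I e j => (encodeNat I.t).length + 1 + (j + 1) * (j + 3) ≤ I.encode.length)
    PolyFun.length
    (PolyPred.le ((polyFun_length_encodeNat.add (PolyFun.const 1)).add
      (((PolyFun.var 0).add (PolyFun.const 1)).mul ((PolyFun.var 0).add (PolyFun.const 3))))
      PolyFun.length) (fun _ _ _ _ => Iff.rfl)).congr fun I e => ?_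
  have : (Finset.range I.encode.length).filter
      (fun j => (encodeNat I.t).length + 1 + (j + 1) * (j + 3) ≤ I.encode.length) =
      Finset.range I.n := by
    ext j
    have h0 := I.n_le_length_encode
    rw [length_encode] at h0 ⊢
    simp only [Finset.mem_filter, Finset.mem_range]
    refine ⟨fun h => ?_, fun h => ⟨by omega, ?_⟩⟩
    · by_contra hj
      nlinarith [h.2]
    · have := Nat.mul_le_mul (show j + 1 ≤ I.n by omega) (show j + 3 ≤ I.n + 2 by omega)
      omega
  rw [this, Finset.card_range]

theorem polyPred_memX (ha : PolyFun encode a) : PolyPred encode fun I e => I.MemX (a I e) := by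
  refine ((PolyPred.lt ha polyFun_n).and (PolyPred.symbol (.bit true)
    ((polyFun_length_encodeNat.add (PolyFun.const 1)).add
      ((ha.mul (polyFun_n.add (PolyFun.const 2))).add (PolyFun.const 0))))).congr fun I e => ?_
  constructor
  · rintro ⟨h, hX⟩
    exact ⟨h, by rw [I.getElem?_encode_mem ⟨_, h⟩]; simp [hX]⟩
  · rintro ⟨h, hX⟩
    rw [I.getElem?_encode_mem ⟨_, h⟩] at hX
    exact ⟨h, by simpa using hX⟩

theorem polyPred_adjNat (ha : PolyFun encode a) (hb : PolyFun encode b) :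
    PolyPred encode fun I e => I.AdjNat (a I e) (b I e) := by
  refine ((PolyPred.lt ha polyFun_n).and ((PolyPred.lt hb polyFun_n).and
    (PolyPred.symbol (.bit true) ((polyFun_length_encodeNat.add (PolyFun.const 1)).add
      ((ha.mul (polyFun_n.add (PolyFun.const 2))).add (hb.add (PolyFun.const 1))))))).congr
    fun I e => ?_
  constructor
  · rintro ⟨h, h', hX⟩
    exact ⟨h, h', by rw [I.getElem?_encode_adj ⟨_, h⟩ ⟨_, h'⟩]; simp [hX]⟩
  · rintro ⟨h, h', hX⟩
    rw [I.getElem?_encode_adj ⟨_, h⟩ ⟨_, h'⟩] at hX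
    exact ⟨h, h', by simpa using hX⟩

theorem polyFun_card_X : PolyFun encode fun I _ => I.X.card :=
  (PolyPred.card 0 (by decide) (P := fun I _ j => I.MemX j) polyFun_n
    (polyPred_memX (PolyFun.var 0)) (fun _ _ _ _ => Iff.rfl)).congr fun I e => by
    rw [Finset.card_filter_range]
    simp

theorem polyFun_degree : PolyFun encode fun I e =>
    ((Finset.range I.n).filter fun j => I.AdjNat (e 0) j).card :=
  PolyPred.card 1 (by decide) (P := fun I e j => I.AdjNat (e 0) j) polyFun_n
    (polyPred_adjNat (PolyFun.var 0) (PolyFun.var 1)) (fun I e j y => by simp)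

/-- Saturated adjacency of the numbers in variables `1` and `2`. -/
theorem polyPred_satAdjNat : PolyPred encode fun I e => I.SatAdjNat (e 1) (e 2) := by
  have hc : PolyFun encode fun I e => ((Finset.range I.n).filter fun j =>
      ¬ I.MemX j ∧ I.AdjNat j (e 1) ∧ I.AdjNat j (e 2)).card :=
    PolyPred.card 3 (by decide)
      (P := fun I e j => ¬ I.MemX j ∧ I.AdjNat j (e 1) ∧ I.AdjNat j (e 2)) polyFun_n
      ((polyPred_memX (PolyFun.var 3)).not.and
        ((polyPred_adjNat (PolyFun.var 3) (PolyFun.var 1)).and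
          (polyPred_adjNat (PolyFun.var 3) (PolyFun.var 2)))) (fun I e j y => by simp)
  refine ((polyPred_adjNat (PolyFun.var 1) (PolyFun.var 2)).or
    ((PolyPred.eq (PolyFun.var 1) (PolyFun.var 2)).not.and
      ((polyPred_memX (PolyFun.var 1)).and ((polyPred_memX (PolyFun.var 2)).and
        (PolyPred.le ((polyFun_card_X.mul polyFun_card_X).add (PolyFun.const 2)) hc))))).congr
    fun I e => ?_
  by_cases h1 : e 1 < I.n
  · by_cases h2 : e 2 < I.n
    · obtain ⟨i, hi⟩ : ∃ i : Fin I.n, (i : ℕ) = e 1 := ⟨⟨_, h1⟩, rfl⟩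
      obtain ⟨j, hj⟩ : ∃ j : Fin I.n, (j : ℕ) = e 2 := ⟨⟨_, h2⟩, rfl⟩
      rw [← hi, ← hj, Finset.card_filter_range]
      simp only [satAdjNat_coe, adjNat_coe, memX_coe, Fin.val_inj, ← sq]
      simp only [saturation, commonOutside, ne_eq]
      convert Iff.rfl
    · simp [SatAdjNat, AdjNat, MemX, h2]
  · simp [SatAdjNat, AdjNat, MemX, h1]

/-- Removability of the number in variable `0`. -/
theorem polyPred_removableNat : PolyPred encode fun I e => I.RemovableNat (e 0) := by
  refine ((PolyPred.lt (PolyFun.var 0) polyFun_n).and ((polyPred_memX (PolyFun.var 0)).not.and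
    (PolyPred.forall_lt 1 (by decide)
      (P := fun I e u => ∀ w < I.n, ¬ (I.AdjNat (e 0) u ∧ I.AdjNat (e 0) w ∧ u ≠ w ∧
        ¬ I.SatAdjNat u w)) polyFun_n
      (PolyPred.forall_lt 2 (by decide)
        (P := fun I e w => ¬ (I.AdjNat (e 0) (e 1) ∧ I.AdjNat (e 0) w ∧ e 1 ≠ w ∧
          ¬ I.SatAdjNat (e 1) w)) polyFun_n
        ((polyPred_adjNat (PolyFun.var 0) (PolyFun.var 1)).and
          ((polyPred_adjNat (PolyFun.var 0) (PolyFun.var 2)).and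
            ((PolyPred.eq (PolyFun.var 1) (PolyFun.var 2)).not.and
              polyPred_satAdjNat.not))).not (fun I e j y => by simp))
      (fun I e j y => by simp)))).congr fun I e => ?_
  by_cases h0 : e 0 < I.n
  · obtain ⟨v, hv⟩ : ∃ v : Fin I.n, (v : ℕ) = e 0 := ⟨⟨_, h0⟩, rfl⟩
    rw [← hv]
    simp only [removableNat_coe, memX_coe, IsRemovable, v.2, true_and]
    refine and_congr_right fun _ => ⟨fun h u hu w hw => ?_, fun h u w hu hw huw => ?_⟩
    · rintro ⟨h1, h2, h3, h4⟩
      refine h4 ⟨hu, hw, h ⟨u, hu⟩ ⟨w, hw⟩ ?_ ?_ ?_⟩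
      · simpa [AdjNat, hu] using h1
      · simpa [AdjNat, hw] using h2
      · simpa using h3
    · by_contra h1
      exact h u u.2 w w.2 ⟨by simpa using hu, by simpa using hw, by simpa [Fin.val_inj] using huw,
        by simpa using h1⟩
  · simp [RemovableNat, h0]

/-- Removability of the number in a variable. -/
theorem polyPred_removableNat_var (i : Fin 6) (h0 : i ≠ 0) (h5 : i ≠ 5) :
    PolyPred encode fun I e => I.RemovableNat (e i) :=
  -- A bounded search copies the value of variable `i` to variable `0`, the only one that
  -- `polyPred_removableNat` reads.
  (PolyPred.exists_lt 0 (by decide) (P := fun I e j => j = e i ∧ I.RemovableNat j) polyFun_n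
    ((PolyPred.eq (PolyFun.var 0) (PolyFun.var i)).and polyPred_removableNat)
    (fun I e j y => by simp [h0, h5])).congr fun I e =>
    ⟨fun h => ⟨e i, h.1, rfl, h⟩, fun ⟨_, _, h1, h2⟩ => h1 ▸ h2⟩

/-- Being written in binary, `t` can be exponential in the length of the code and then has no unary
form of polynomial size. The cap loses nothing, since `t` is only compared with `|X| + 1` and with
degrees plus one, all at most `n + 1`. -/
theorem polyFun_min_t : PolyFun encode fun I _ => min I.t (I.n + 2) := by
  have hg : PolyFun encode fun I e =>
      min (2 * e 5 + if I.encode[e 0]? = some (.bit true) then 1 else 0) (I.n + 2) := by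
    have h1 : PolyFun encode fun I e =>
        2 * e 5 + if I.encode[e 0]? = some (.bit true) then 1 else 0 :=
      ((PolyFun.const 2).mul (PolyFun.var 5)).add (PolyPred.symbol _ (PolyFun.var 0)).indicator
    -- The minimum of `y` and `c` is `y - (y - c)` in truncated subtraction.
    exact (h1.sub (h1.sub (polyFun_n.add (PolyFun.const 2)))).congr fun I e => by omega
  refine (PolyFun.foldr (k := 0) (by decide) polyFun_length_encodeNat hg (.X + 2) ?_).congr
    fun I e => ?_
  · intro I e N hN _ j _
    have := I.n_le_length_encode
    rcases List.range' j ((encodeNat I.t).length - j) with _ | ⟨q, l⟩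
    · simp
    · simp only [List.foldr_cons, Polynomial.eval_add, Polynomial.eval_X, Polynomial.eval_ofNat]
      omega
  · have h1 : (List.range (encodeNat I.t).length).map
        (fun j => decide (I.encode[j]? = some (.bit true))) = encodeNat I.t := by
      refine List.ext_getElem (by simp) fun j h1 h2 => ?_
      simp [I.getElem?_encode_of_lt h2]
    have h2 := foldr_min (I.n + 2) (encodeNat I.t)
    rw [foldr_encodeNat, ← h1, List.foldr_map] at h2
    rw [← h2]
    congr 1
    funext j y
    by_cases hj : I.encode[j]? = some (.bit true) <;> simp [hj]

theorem polyPred_card_lt_t : PolyPred encode fun I _ => I.X.card + 1 < I.t :=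
  (PolyPred.lt (polyFun_card_X.add (PolyFun.const 1)) polyFun_min_t).congr fun I e => by
    have : I.X.card ≤ I.n := by simpa using Finset.card_le_univ I.X
    omega

theorem polyPred_hasLargeRemovable : PolyPred encode fun I _ => I.HasLargeRemovable := by
  refine (PolyPred.exists_lt 0 (by decide) (P := fun I e v => I.RemovableNat v ∧
    min I.t (I.n + 2) ≤ ((Finset.range I.n).filter fun j => I.AdjNat v j).card + 1) polyFun_n
    (polyPred_removableNat.and (PolyPred.le polyFun_min_t (polyFun_degree.add (PolyFun.const 1))))
    (fun _ _ _ _ => Iff.rfl)).congr fun I e => ?_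
  have hle : ∀ v, ((Finset.range I.n).filter fun j => I.AdjNat v j).card ≤ I.n := fun v => by
    simpa using Finset.card_filter_le (Finset.range I.n) fun j => I.AdjNat v j
  have hcard : ∀ v : Fin I.n, ((Finset.range I.n).filter fun j => I.AdjNat v j).card =
      (Finset.univ.filter fun a => I.G.Adj v a).card := fun v => by
    rw [Finset.card_filter_range]; simp
  constructor
  · rintro ⟨v, hv, ht⟩
    refine ⟨v, v.2, by simpa using hv, ?_⟩
    rw [hcard]
    omega
  · rintro ⟨v, hvn, hv, ht⟩
    lift v to Fin I.n using hvn
    refine ⟨v, by simpa using hv, ?_⟩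
    have := hle v
    rw [← hcard]
    omega

theorem encodeNat_one : encodeNat 1 = [true] := rfl

theorem encode_noInstance : noInstance.encode = [.bit true, .comma] := by
  simp [encode, noInstance, encodeNat_one]

theorem encode_yesInstance :
    yesInstance.encode = [.bit true, .comma, .bit false, .bit false, .comma] := by
  simp [encode, yesInstance, encodeNat_one, encodeRow, List.finRange_succ]

/-- This form can be written by nested loops without renumbering vertices: skipping the removable
ones in a loop over all numbers yields the order of `kept`. The digits of `t` are copied and never
evaluated. -/
theorem encode_reduced (I : CliqueMinorInstance) :
    I.reduced.encode =
      ((List.range (encodeNat I.t).length).flatMap fun p =>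
        if I.encode[p]? = some (.bit true) then [.bit true] else [.bit false]) ++ ([.comma] ++
      (List.range I.n).flatMap fun v => if I.RemovableNat v then [] else
        (if I.MemX v then [.bit true] else [.bit false]) ++
        (((List.range I.n).flatMap fun w => if I.RemovableNat w then [] else
          if I.SatAdjNat v w then [.bit true] else [.bit false]) ++ [.comma])) := by
  have hbit : ∀ (p : Prop) [Decidable p],
      (if p then [Γ'.bit true] else [Γ'.bit false]) = [Γ'.bit (decide p)] := by
    intro p _
    by_cases h : p <;> simp [h]
  have h1 : ((List.range (encodeNat I.t).length).flatMap fun p =>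
      if I.encode[p]? = some (Γ'.bit true) then [Γ'.bit true] else [Γ'.bit false]) =
      (encodeNat I.t).map Γ'.bit := by
    rw [List.flatMap_range]
    conv_rhs => rw [← List.map_get_finRange (encodeNat I.t), List.map_map, List.map_eq_flatMap]
    refine congrArg (List.flatMap · _) (funext fun p => ?_)
    rw [hbit, I.getElem?_encode_of_lt p.2]
    simp
  have h2 : ∀ (l : List (Fin I.n)) (f : Fin I.n → List Γ'),
      (List.finRange l.length).flatMap (fun i => f (l.get i)) = l.flatMap f := by
    intro l f
    conv_rhs => rw [← List.map_get_finRange l]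
    exact (List.flatMap_map ..).symm
  have h3 : ∀ f : ℕ → List Γ',
      ((List.range I.n).flatMap fun v => if I.RemovableNat v then [] else f v) =
        (List.finRange I.kept.length).flatMap fun i => f (I.kept.get i) := by
    intro f
    rw [h2 I.kept fun v => f v, kept, List.flatMap_filter_eq, List.flatMap_range]
    refine congrArg (List.flatMap · _) (funext fun v => ?_)
    by_cases h : IsRemovable I.G I.X v <;> simp [h]
  rw [h1, h3, encode]
  refine congrArg₂ _ rfl (congrArg (List.cons _) (congrArg (List.flatMap · _) ?_))
  funext i
  rw [h3, encodeRow, hbit, List.map_eq_flatMap]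
  simp only [hbit]
  have e1 : I.MemX (I.kept.get i) ↔ i ∈ I.reduced.X := by
    rw [memX_coe]
    exact (Finset.mem_preimage (hf := I.kept_get_injective.injOn)).symm
  have e2 : ∀ j, I.SatAdjNat (I.kept.get i) (I.kept.get j) ↔ I.reduced.G.Adj i j := fun j =>
    satAdjNat_coe _ _
  simp only [e1, e2]
  rfl

theorem polyOut_kernel : PolyOut encode fun I _ => I.kernel.encode := by
  have hrow : PolyOut encode fun I e => (List.range I.n).flatMap fun w =>
      if I.RemovableNat w then [] else
        if I.SatAdjNat (e 1) w then [.bit true] else [.bit false] :=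
    PolyOut.flatMap 2 (o := fun I e w => if I.RemovableNat w then [] else
        if I.SatAdjNat (e 1) w then [.bit true] else [.bit false]) polyFun_n
      (.ite (polyPred_removableNat_var 2 (by decide) (by decide)) .nil
        (.ite polyPred_satAdjNat (.single _) (.single _))) (fun I e j => by simp)
  have hrows := PolyOut.flatMap 1 (o := fun I e v => if I.RemovableNat v then [] else
      (if I.MemX v then [.bit true] else [.bit false]) ++
        (((List.range I.n).flatMap fun w => if I.RemovableNat w then [] else
          if I.SatAdjNat v w then [.bit true] else [.bit false]) ++ [.comma])) polyFun_n
    (.ite (polyPred_removableNat_var 1 (by decide) (by decide)) .nil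
      ((PolyOut.ite (polyPred_memX (.var 1)) (.single _) (.single _)).append
        (hrow.append (.single .comma)))) (fun I e j => rfl)
  have ht := PolyOut.flatMap 0 (o := fun (I : CliqueMinorInstance) e p =>
      if I.encode[p]? = some (.bit true) then [.bit true] else [.bit false])
    polyFun_length_encodeNat (.ite (PolyPred.symbol _ (.var 0)) (.single _) (.single _))
    (fun I e j => rfl)
  have hno : PolyOut encode fun I _ => noInstance.encode :=
    ((PolyOut.single (.bit true)).append (.single .comma)).congr fun _ _ => encode_noInstance
  have hyes : PolyOut encode fun I _ => yesInstance.encode :=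
    ((PolyOut.single (.bit true)).append ((PolyOut.single .comma).append
      ((PolyOut.single (.bit false)).append ((PolyOut.single (.bit false)).append
        (.single .comma))))).congr fun _ _ => encode_yesInstance
  have hred : PolyOut encode fun I _ => I.reduced.encode :=
    (ht.append ((PolyOut.single .comma).append hrows)).congr fun I _ => I.encode_reduced
  refine (PolyOut.ite polyPred_card_lt_t hno
    (.ite polyPred_hasLargeRemovable hyes hred)).congr fun I _ => ?_
  unfold kernel
  by_cases h1 : I.X.card + 1 < I.t
  · simp only [h1, if_true]
  by_cases h2 : I.HasLargeRemovable <;> simp only [h1, h2, if_true, if_false]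

end CliqueMinorInstance

end

/-! ### The polynomial kernel. -/

theorem theorem4p1 :
    ∃ (K : CliqueMinorInstance → CliqueMinorInstance) (f : ℕ → ℕ) (g : ℕ → ℕ),
      IsKernelization cliqueMinorTestVC K f ∧
      (∃ p : Polynomial ℕ, ∀ k, f k ≤ p.eval k) ∧
      Asymptotics.IsBigO Filter.atTop (fun k : ℕ => (g k : ℝ)) (fun k : ℕ => (k : ℝ) ^ 4) ∧
      ∀ I : CliqueMinorInstance, (K I).n ≤ g I.X.card := by
  set g : ℕ → ℕ := fun k => k + k ^ 2 * (k ^ 2 + 1) + 1 with hg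
  -- At most `k + 1` symbols for `t`, one comma, and at most `g k` rows of length at most `g k + 2`.
  set f : ℕ → ℕ := fun k => k + 2 + g k * (g k + 2) with hf
  refine ⟨CliqueMinorInstance.kernel, f, g, ⟨?_, ?_, ?_, ?_, ?_⟩, ?_, ?_, ?_⟩
  · exact CliqueMinorInstance.polyOut_kernel.nonempty_computableInPolyTime
  · exact CliqueMinorInstance.hasMinor_kernel_iff
  · have hp : Primrec f := by
      have hpow : Primrec fun k : ℕ => k ^ 2 :=
        (Primrec.nat_mul.comp .id .id).of_eq fun k => (sq k).symm
      have hgp : Primrec g := Primrec.nat_add.comp (Primrec.nat_add.comp .id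
        (Primrec.nat_mul.comp hpow (Primrec.nat_add.comp hpow (.const 1)))) (.const 1)
      exact Primrec.nat_add.comp (Primrec.nat_add.comp .id (.const 2))
        (Primrec.nat_mul.comp hgp (Primrec.nat_add.comp hgp (.const 2)))
    exact hp.to_comp
  · intro I
    change I.kernel.encode.length ≤ f I.X.card
    rw [CliqueMinorInstance.length_encode]
    have h1 : I.kernel.n ≤ g I.X.card := I.kernel_n_le
    have h2 := (length_encodeNat_le I.kernel.t).trans I.kernel_t_le
    have h3 := Nat.mul_le_mul h1 (Nat.add_le_add_right h1 2)
    simp only [hf]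
    omega
  · intro I
    refine I.kernel_X_card_le.trans ?_
    change I.X.card ≤ f I.X.card
    simp only [hf]
    omega
  · refine ⟨.X + 2 + (.X + .X ^ 2 * (.X ^ 2 + 1) + 1) * (.X + .X ^ 2 * (.X ^ 2 + 1) + 1 + 2),
      fun k => ?_⟩
    simp [hf, hg]
  -- `g k = k ^ 4 + k ^ 2 + k + 1` has four terms, each at most `k ^ 4` for `k ≥ 1`.
  · refine Asymptotics.IsBigO.of_bound 4 ?_
    filter_upwards [Filter.eventually_ge_atTop 1] with k hk
    have h : g k ≤ 4 * k ^ 4 := by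
      have h1 : k ≤ k ^ 4 := Nat.le_self_pow (by norm_num) k
      have h2 : k ^ 2 ≤ k ^ 4 := Nat.pow_le_pow_right hk (by norm_num)
      have h3 : 1 ≤ k ^ 4 := Nat.one_le_pow _ _ hk
      have h4 : k ^ 2 * (k ^ 2 + 1) = k ^ 4 + k ^ 2 := by ring
      simp only [hg]
      omega
    rw [Real.norm_of_nonneg (by positivity), Real.norm_of_nonneg (by positivity)]
    exact_mod_cast h
  · exact CliqueMinorInstance.kernel_n_le
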